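/- Let $A$, $B$ be finite alphabets. A sequence $x\in A^{\mathbb Z}$ is \emph{Toeplitz} if for every $n\in\mathbb Z$ there is $p\ge 1$ with $x(n+kp)=x(n)$ for all $k\in\mathbb Z$ (periodic sequences are allowed); a \emph{Toeplitz subshift} is the closure of the shift orbit of a Toeplitz sequence, together with the left shift. For a homeomorphism $T$ of a space $X$, the \emph{stabilized automorphism group} is $\operatorname{Aut}^{(\infty)}(X,T)=\bigcup_{n\ge 1}\{\varphi\in\operatorname{Homeo}(X):\varphi\circ T^n=T^n\circ\varphi\}$. For positive integers $p_0\mid p_1\mid p_2\mid\cdots$, the \emph{odometer} with scale $(p_n)$ is the inverse limit $\varprojlim\mathbb Z/p_n\mathbb Z$ with the map $z\mapsto z+1$. The \emph{maximal equicontinuous factor} of $(X,T)$ is an equicontinuous factor of $(X,T)$ on a compact metrizable space through which every equicontinuous factor of $(X,T)$ on a compact metrizable space factors; it is unique up to conjugacy. Let $(X,T)\subseteq A^{\mathbb Z}$ and $(Y,S)\subseteq B^{\mathbb Z}$ be Toeplitz subshifts. If $\operatorname{Aut}^{(\infty)}(X,T)$ and $\operatorname{Aut}^{(\infty)}(Y,S)$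 are isomorphic as groups, then there is an odometer that is the maximal equicontinuous factor of both $(X,T)$ and $(Y,S)$; moreover, if $X$ or $Y$ is infinite, then this odometer is infinite. -/

import Mathlib

open SymbolicDynamics.FullShift Topology

/-- The stabilized automorphism group `⋃_{n ≥ 1} Aut(X, T ^ n)` of a homeomorphism `T` of `X`:
the homeomorphisms of `X` that commute with some power `T ^ n`, `n ≥ 1`. -/
def stabilizedAut {X : Type*} [TopologicalSpace X] (T : X ≃ₜ X) : Subgroup (X ≃ₜ X) where
  carrier := {φ | ∃ n : ℕ, 1 ≤ n ∧ φ * T ^ n = T ^ n * φ}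
  one_mem' := ⟨1, le_rfl, by simp⟩
  mul_mem' := by
    rintro φ ψ ⟨m, hm, hφ⟩ ⟨n, hn, hψ⟩
    refine ⟨m * n, Nat.mul_pos hm hn, ?_⟩
    have h1 : Commute φ (T ^ (m * n)) := by
      rw [pow_mul]; exact Commute.pow_right hφ n
    have h2 : Commute ψ (T ^ (m * n)) := by
      rw [mul_comm m n, pow_mul]; exact Commute.pow_right hψ m
    exact h1.mul_left h2
  inv_mem' := by
    rintro φ ⟨n, hn, hφ⟩
    exact ⟨n, hn, Commute.inv_left hφ⟩

/-- The left shift `(x_n) ↦ (x_{n+1})` as a homeomorphism of a two-sided subshift. -/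
def subshiftHomeo {A : Type*} [TopologicalSpace A] (X : Subshift A ℤ) :
    X.carrier ≃ₜ X.carrier where
  toFun x := ⟨shift 1 x.1, X.mapsTo 1 x.2⟩
  invFun x := ⟨shift (-1) x.1, X.mapsTo (-1) x.2⟩
  left_inv x := by ext n; simp
  right_inv x := by ext n; simp
  continuous_toFun := by fun_prop
  continuous_invFun := by fun_prop

/-- A bi-infinite sequence is Toeplitz if each coordinate is repeated periodically. -/
def IsToeplitzSequence {A : Type*} (x : ℤ → A) : Prop :=
  ∀ n : ℤ, ∃ p : ℕ, 1 ≤ p ∧ ∀ k : ℤ, x (n + k * p) = x n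

/-- A Toeplitz subshift is the shift-orbit closure of a Toeplitz sequence. -/
def IsToeplitzSubshift {A : Type*} [TopologicalSpace A] (X : Subshift A ℤ) : Prop :=
  ∃ x : ℤ → A, IsToeplitzSequence x ∧ X.carrier = closure (Set.range fun n : ℤ => shift n x)

/-- `π` is a factor map from the system `(X, T)` onto the system `(Y, S)`. -/
structure IsFactorMap {X Y : Type*} [TopologicalSpace X] [TopologicalSpace Y]
    (T : X ≃ₜ X) (S : Y ≃ₜ Y) (π : X → Y) : Prop where
  continuous : Continuous π
  surjective : Function.Surjective π
  equivariant : ∀ x, π (T x) = S (π x)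

/-- A homeomorphism `S` of a compact metrizable space is equicontinuous if the family
`(S ^ n : n ∈ ℤ)` is, for the unique uniform structure compatible with the topology (that is,
for any compatible metric). -/
def IsEquicontinuousSystem {Y : Type*} [TopologicalSpace Y] [CompactSpace Y]
    [TopologicalSpace.MetrizableSpace Y] (S : Y ≃ₜ Y) : Prop :=
  letI : UniformSpace Y := uniformSpaceOfCompactR1
  Equicontinuous fun (n : ℤ) (y : Y) => (S ^ n) y

universe uA uB uX uZ uW

/-- `(Z, R)` is the maximal equicontinuous factor of `(X, T)`: it is an equicontinuous factor
through which every equicontinuous factor `(W, Q)` of `(X, T)` factors. -/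
def IsMaximalEquicontinuousFactor {X : Type uX} [TopologicalSpace X] (T : X ≃ₜ X)
    {Z : Type uZ} [TopologicalSpace Z] [CompactSpace Z] [TopologicalSpace.MetrizableSpace Z]
    (R : Z ≃ₜ Z) : Prop :=
  IsEquicontinuousSystem R ∧
    ∃ π : X → Z, IsFactorMap T R π ∧
      ∀ (W : Type uW) [TopologicalSpace W] [CompactSpace W] [TopologicalSpace.MetrizableSpace W]
        (Q : W ≃ₜ W) (ψ : X → W), IsEquicontinuousSystem Q → IsFactorMap T Q ψ →
          ∃ θ : Z → W, IsFactorMap R Q θ ∧ ∀ x, ψ x = θ (π x)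

/-- A scale: a sequence of positive integers, each dividing the next one. -/
structure OdometerScale where
  period : ℕ → ℕ
  pos : ∀ n, 0 < period n
  dvd : ∀ n, period n ∣ period (n + 1)

/-- The space of the odometer with scale `(p_n)`: the inverse limit of the groups `ℤ/p_n ℤ` under
reduction, with the topology induced by the product of the discrete topologies. -/
def Odometer (s : OdometerScale) : Type :=
  {z : ∀ n, ZMod (s.period n) //
    ∀ n, ZMod.castHom (s.dvd n) (ZMod (s.period n)) (z (n + 1)) = z n}

instance (s : OdometerScale) : TopologicalSpace (Odometer s) :=
  instTopologicalSpaceSubtype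

instance (s : OdometerScale) : CompactSpace (Odometer s) := by
  have (n : ℕ) : NeZero (s.period n) := ⟨(s.pos n).ne'⟩
  have h : IsClosed {z : ∀ n, ZMod (s.period n) |
      ∀ n, ZMod.castHom (s.dvd n) (ZMod (s.period n)) (z (n + 1)) = z n} := by
    rw [Set.ofPred_forall]
    refine isClosed_iInter fun n => isClosed_eq ?_ (continuous_apply n)
    exact continuous_of_discreteTopology.comp (continuous_apply (n + 1))
  exact isCompact_iff_compactSpace.mp h.isCompact

instance (s : OdometerScale) : TopologicalSpace.MetrizableSpace (Odometer s) := by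
  have (n : ℕ) : NeZero (s.period n) := ⟨(s.pos n).ne'⟩
  have h : IsEmbedding fun z : Odometer s => z.1 := IsEmbedding.subtypeVal
  have : SecondCountableTopology (Odometer s) := h.secondCountableTopology
  have : T2Space (Odometer s) := h.t2Space
  exact TopologicalSpace.metrizableSpace_of_t3_secondCountable _

/-- The odometer map: translation `z ↦ z + 1`. -/
def odometerHomeo (s : OdometerScale) : Odometer s ≃ₜ Odometer s where
  toFun z := ⟨fun n => z.1 n + 1, fun n => by rw [map_add, z.2 n, map_one]⟩
  invFun z := ⟨fun n => z.1 n - 1, fun n => by rw [map_sub, z.2 n, map_one]⟩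
  left_inv z := Subtype.ext (funext fun n => by simp)
  right_inv z := Subtype.ext (funext fun n => by simp)
  continuous_toFun := by
    refine Continuous.subtype_mk (continuous_pi fun n => ?_) _
    exact (continuous_of_discreteTopology (f := fun a : ZMod (s.period n) => a + 1)).comp
      ((continuous_apply n).comp continuous_subtype_val)
  continuous_invFun := by
    refine Continuous.subtype_mk (continuous_pi fun n => ?_) _
    exact (continuous_of_discreteTopology (f := fun a : ZMod (s.period n) => a - 1)).comp
      ((continuous_apply n).comp continuous_subtype_val)

/-!
A system with a dense orbit through a regularly recurrent point `z` is governed by its *heights*,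
the factor maps onto finite rotations `ℤ/dℤ`. For every `m ≥ 1` the orbit closures of `T ^ m` are
the fibres of a height (`IsRegularlyRecurrent.exists_height`), and the height fibres form a
neighbourhood basis at each point of the orbit of `z`. Hence the set `D` of periods of heights is
closed under least common multiples and under divisors, and the odometer with a scale cofinal in `D`
is the maximal equicontinuous factor: two points with the same heights can be moved by one iterate
of `T` into a given neighbourhood of `z`, so an equicontinuous factor cannot distinguish them
(`IsRegularlyRecurrent.apply_eq_of_height_eq`). It remains to recover `D` from the stabilized
automorphism group `G`.

If the space is finite, `G` is the full symmetric group, whose order determines the number of points.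
If it is infinite, call a clopen set periodic if some power of `T` preserves it. The group `G` acts on
the Boolean algebra of these sets, and it contains the localization of each of its elements `h` to an
`h`-invariant periodic clopen set. A number `n` lies in `D` exactly if `G` contains an element `g` of
order `n` none of whose nontrivial powers is the identity on a nonempty periodic clopen set: given a
height of period `n`, let `g` follow `T` through the fibres and return from the last to the first;
conversely, `g` permutes the minimal components of a suitable power of `T` freely, so `n` divides
their number, which belongs to `D`.

This form of freeness is a property of the abstract group (`IsAlgebraicallyFree`). If `h` has finite
order and no fixed points, the localizations of `h` to invariant sets commute with each other, and
these sets are permuted by the centralizer of `h`. So an `f` in the centralizer either preserves all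
of them, and then moves the points of the orbit of `z` within `h`-orbits and commutes with its own
conjugates under the centralizer, or has a commutator with such a localization that is nontrivial
and commutes with its conjugates. If `h` is the identity on a nonempty periodic clopen set, an
element `f` supported there violates this: any candidate `c` displaces a small periodic clopen set
on which `h` is the identity, and conjugating `c` by a localization of a power of `T` to that set
gives an element that does not commute with `c`.
-/

open scoped commutatorElement

/-! ### Regularly recurrent systems and their heights -/

/-- The point `z` has a dense `T`-orbit and is regularly recurrent: it returns to each of its
neighbourhoods along an arithmetic progression of times. -/
structure IsRegularlyRecurrent {X : Type*} [TopologicalSpace X] (T : X ≃ₜ X) (z : X) : Prop where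
  dense : Dense (Set.range fun k : ℤ => (T ^ k) z)
  recurrent : ∀ V ∈ 𝓝 z, ∃ p : ℕ, 0 < p ∧ ∀ k : ℤ, (T ^ ((p : ℤ) * k)) z ∈ V

/-- A height of period `d` is a factor map onto the rotation of `ℤ/dℤ` by `1`. For `d ≥ 1` and a
nonempty space surjectivity is automatic and therefore not required. -/
structure IsHeight {X : Type*} [TopologicalSpace X] (T : X ≃ₜ X) (d : ℕ) (f : X → ZMod d) :
    Prop where
  continuous : Continuous f
  map_apply : ∀ x, f (T x) = f x + 1

/-- The positive periods of the heights of `T`. -/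
def heightPeriods {X : Type*} [TopologicalSpace X] (T : X ≃ₜ X) : Set ℕ :=
  {d | 0 < d ∧ ∃ f : X → ZMod d, IsHeight T d f}

/-- The closure of the orbit of `x` under `T ^ m`. -/
def orbitClosure {X : Type*} [TopologicalSpace X] (T : X ≃ₜ X) (m : ℕ) (x : X) : Set X :=
  closure (Set.range fun k : ℤ => (T ^ ((m : ℤ) * k)) x)

section Heights

variable {X : Type*} [TopologicalSpace X] {T : X ≃ₜ X}

theorem zpow_add_apply (T : X ≃ₜ X) (a b : ℤ) (x : X) : (T ^ (a + b)) x = (T ^ a) ((T ^ b) x) := by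
  rw [zpow_add]; rfl

theorem zpow_neg_apply_apply (T : X ≃ₜ X) (a : ℤ) (x : X) : (T ^ (-a)) ((T ^ a) x) = x := by
  rw [← zpow_add_apply]; simp

theorem zpow_apply_neg_apply (T : X ≃ₜ X) (a : ℤ) (x : X) : (T ^ a) ((T ^ (-a)) x) = x := by
  rw [← zpow_add_apply]; simp

theorem mem_orbitClosure_self (T : X ≃ₜ X) (m : ℕ) (x : X) : x ∈ orbitClosure T m x :=
  subset_closure ⟨0, by simp⟩

theorem orbitClosure_subset {m : ℕ} {x : X} {C : Set X} (hC : IsClosed C)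
    (h : ∀ k : ℤ, (T ^ ((m : ℤ) * k)) x ∈ C) : orbitClosure T m x ⊆ C :=
  closure_minimal (by rintro _ ⟨k, rfl⟩; exact h k) hC

theorem zpow_mem_orbitClosure {m : ℕ} {x y : X} (h : y ∈ orbitClosure T m x) (j : ℤ) :
    (T ^ j) y ∈ orbitClosure T m ((T ^ j) x) := by
  have : orbitClosure T m x ⊆ (T ^ j) ⁻¹' orbitClosure T m ((T ^ j) x) := by
    refine orbitClosure_subset (isClosed_closure.preimage (T ^ j).continuous) fun k => ?_
    refine subset_closure ⟨k, ?_⟩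
    simp only [← zpow_add_apply, add_comm]
  exact this h

theorem zpow_mul_mem_orbitClosure {m : ℕ} {x y : X} (h : y ∈ orbitClosure T m x) (k : ℤ) :
    (T ^ ((m : ℤ) * k)) y ∈ orbitClosure T m x := by
  have : orbitClosure T m x ⊆ (T ^ ((m : ℤ) * k)) ⁻¹' orbitClosure T m x := by
    refine orbitClosure_subset (isClosed_closure.preimage (T ^ ((m : ℤ) * k)).continuous) fun l => ?_
    refine subset_closure ⟨k + l, ?_⟩
    simp only [← zpow_add_apply, mul_add]
  exact this h

theorem orbitClosure_subset_of_mem {m : ℕ} {x y : X} (h : y ∈ orbitClosure T m x) :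
    orbitClosure T m y ⊆ orbitClosure T m x :=
  orbitClosure_subset isClosed_closure (zpow_mul_mem_orbitClosure h)

/-- The orbit closure of a regularly recurrent point under a power of `T` is minimal. -/
theorem IsRegularlyRecurrent.mem_orbitClosure_symm [RegularSpace X] {z : X}
    (hz : IsRegularlyRecurrent T z) {m : ℕ} {y : X} (hy : y ∈ orbitClosure T m z) :
    z ∈ orbitClosure T m y := by
  refine mem_closure_iff_nhds.2 fun W hW => ?_
  obtain ⟨V, hV, hVc, hVW⟩ := exists_mem_nhds_isClosed_subset hW
  obtain ⟨p, hp, hpV⟩ := hz.recurrent V hV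
  have hsub : orbitClosure T m z ⊆
      ⋃ i ∈ Finset.range p, (T ^ (-((m : ℤ) * (i : ℤ)))) ⁻¹' V := by
    refine orbitClosure_subset ?_ fun k => ?_
    · exact Set.Finite.isClosed_biUnion (Finset.finite_toSet _)
        fun i _ => hVc.preimage (T ^ (-((m : ℤ) * (i : ℤ)))).continuous
    · have hp' : (0 : ℤ) < p := by exact_mod_cast hp
      have h0 := Int.emod_nonneg k hp'.ne'
      have h1 := Int.emod_lt_of_pos k hp'
      simp only [Set.mem_iUnion, Set.mem_preimage, Finset.mem_range]
      refine ⟨(k % p).toNat, by omega, ?_⟩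
      rw [← zpow_add_apply, Int.toNat_of_nonneg h0]
      have : -((m : ℤ) * (k % p)) + m * k = p * (m * (k / p)) := by
        have := Int.emod_add_mul_ediv k p
        linear_combination (m : ℤ) * (-this)
      rw [this]
      exact hpV _
  have := hsub hy
  simp only [Set.mem_iUnion, Set.mem_preimage] at this
  obtain ⟨i, -, hi⟩ := this
  exact ⟨_, hVW hi, -i, by simp⟩

theorem IsHeight.map_zpow {d : ℕ} {f : X → ZMod d} (hf : IsHeight T d f) (k : ℤ) (x : X) :
    f ((T ^ k) x) = f x + k := by
  induction k with
  | zero => simp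
  | succ n ih =>
    rw [add_comm, zpow_add_apply, zpow_one, hf.map_apply, ih]; push_cast; ring
  | pred n ih =>
    have h := hf.map_apply ((T ^ (-(n : ℤ) - 1)) x)
    have h2 : T ((T ^ (-(n : ℤ) - 1)) x) = (T ^ (-(n : ℤ))) x := by
      conv_lhs => rw [← zpow_one T, ← zpow_mul, one_mul, ← zpow_add_apply]
      congr 2; ring
    rw [h2, ih] at h
    push_cast at h ⊢
    linear_combination -h

theorem IsHeight.surjective {d : ℕ} [NeZero d] {f : X → ZMod d} (hf : IsHeight T d f) (x : X) :
    Function.Surjective f := fun a =>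
  ⟨(T ^ ((a - f x).val : ℤ)) x, by rw [hf.map_zpow]; simp⟩

theorem eq_of_mem_orbitClosure {α : Type*} [TopologicalSpace α] [T1Space α] {m : ℕ} {F : X → α}
    (hF : Continuous F) (hm : ∀ x, F ((T ^ m) x) = F x) {x y : X} (h : y ∈ orbitClosure T m x) :
    F y = F x := by
  have hk : ∀ k : ℤ, ∀ x, F ((T ^ ((m : ℤ) * k)) x) = F x := by
    intro k
    induction k with
    | zero => simp
    | succ n ih =>
      intro x
      rw [mul_add, mul_one, zpow_add_apply, ih, zpow_natCast, hm]
    | pred n ih =>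
      intro x
      rw [mul_sub, mul_one, sub_eq_add_neg, zpow_add_apply, ih, ← hm, ← zpow_natCast,
        zpow_apply_neg_apply]
  exact orbitClosure_subset (C := F ⁻¹' {F x}) (isClosed_singleton.preimage hF)
    (fun k => hk k x) h

/-- For every `m ≥ 1` there is a height whose fibres are the orbit closures of `T ^ m`. Its period
is the number of minimal components of `T ^ m`. -/
theorem IsRegularlyRecurrent.exists_height [RegularSpace X] {z : X}
    (hz : IsRegularlyRecurrent T z) {m : ℕ} (hm : 0 < m) :
    ∃ c : ℕ, 0 < c ∧ c ∣ m ∧ ∃ f : X → ZMod c, IsHeight T c f ∧ f z = 0 ∧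
      ∀ x y, f x = f y → y ∈ orbitClosure T m x := by
  set U := orbitClosure T m z with hU
  -- the times at which `z` visits its own `T ^ m`-orbit closure
  have hadd : ∀ {j : ℤ} {y : X}, (T ^ j) z ∈ U → y ∈ U → (T ^ j) y ∈ U := fun hj hy =>
    orbitClosure_subset_of_mem hj (zpow_mem_orbitClosure hy _)
  have hneg : ∀ {j : ℤ}, (T ^ j) z ∈ U → (T ^ (-j)) z ∈ U := by
    intro j hj
    have := zpow_mem_orbitClosure (hz.mem_orbitClosure_symm hj) (-j)
    rwa [zpow_neg_apply_apply] at this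
  let H : AddSubgroup ℤ :=
    { carrier := {j | (T ^ j) z ∈ U}
      zero_mem' := by simpa using mem_orbitClosure_self T m z
      add_mem' := fun {a b} ha hb => by
        change (T ^ (a + b)) z ∈ U
        rw [zpow_add_apply]; exact hadd ha hb
      neg_mem' := fun ha => hneg ha }
  have hHmem : ∀ j, j ∈ H ↔ (T ^ j) z ∈ U := fun j => Iff.rfl
  obtain ⟨a, ha⟩ := Int.subgroup_cyclic H
  have hHa : ∀ j : ℤ, (T ^ j) z ∈ U ↔ (a.natAbs : ℤ) ∣ j := by
    intro j
    rw [← hHmem, ha, ← AddSubgroup.zmultiples_eq_closure, Int.mem_zmultiples_iff, Int.natAbs_dvd]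
  have hmH : (T ^ (m : ℤ)) z ∈ U := subset_closure ⟨1, by simp⟩
  have hcm : a.natAbs ∣ m := by
    have := (hHa m).1 hmH
    exact_mod_cast this
  have hc : 0 < a.natAbs := Nat.pos_of_dvd_of_pos hcm hm
  set c := a.natAbs
  have : NeZero c := ⟨hc.ne'⟩
  have huniq : ∀ {x : X} {k l : ℤ}, (T ^ (-k)) x ∈ U → (T ^ (-l)) x ∈ U → (c : ℤ) ∣ k - l := by
    intro x k l hk hl
    rw [← hHa]
    have h1 := zpow_mem_orbitClosure hk (k - l)
    rw [← zpow_add_apply, show k - l + -k = -l by ring] at h1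
    have h2 := orbitClosure_subset_of_mem h1 (hz.mem_orbitClosure_symm hl)
    have h3 := zpow_mem_orbitClosure h2 (-(k - l))
    rw [zpow_neg_apply_apply] at h3
    simpa using hneg h3
  have hex : ∀ x : X, ∃ k : ℤ, (T ^ (-k)) x ∈ U := by
    have hcl : IsClosed (⋃ i ∈ Finset.range m, (T ^ (-(i : ℤ))) ⁻¹' U) :=
      Set.Finite.isClosed_biUnion (Finset.finite_toSet _)
        fun i _ => isClosed_closure.preimage (T ^ (-(i : ℤ))).continuous
    intro x
    have hx : x ∈ ⋃ i ∈ Finset.range m, (T ^ (-(i : ℤ))) ⁻¹' U := by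
      refine closure_minimal ?_ hcl (hz.dense x)
      rintro _ ⟨k, rfl⟩
      have hm' : (0 : ℤ) < m := by exact_mod_cast hm
      have h0 := Int.emod_nonneg k hm'.ne'
      have h1 := Int.emod_lt_of_pos k hm'
      simp only [Set.mem_iUnion, Set.mem_preimage, Finset.mem_range]
      refine ⟨(k % m).toNat, by omega, ?_⟩
      rw [← zpow_add_apply, Int.toNat_of_nonneg h0]
      have : -(k % m) + k = m * (k / m) := by
        have := Int.emod_add_mul_ediv k m
        linear_combination (-this)
      rw [this]
      exact subset_closure ⟨_, rfl⟩
    simp only [Set.mem_iUnion, Set.mem_preimage] at hx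
    obtain ⟨i, -, hi⟩ := hx
    exact ⟨i, hi⟩
  choose r hr using hex
  have hiff : ∀ (x : X) (k : ℤ), ((r x : ℤ) : ZMod c) = (k : ZMod c) ↔ (T ^ (-k)) x ∈ U := by
    intro x k
    constructor
    · intro h
      have h1 : (c : ℤ) ∣ r x - k := by
        have := (ZMod.intCast_eq_intCast_iff_dvd_sub _ _ _).1 h.symm
        exact this
      have h2 := hadd ((hHa _).2 h1) (hr x)
      rwa [← zpow_add_apply, show r x - k + -r x = -k by ring] at h2
    · intro h
      exact ((ZMod.intCast_eq_intCast_iff_dvd_sub _ _ _).2 (huniq (hr x) h)).symm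
  refine ⟨c, hc, hcm, fun x => (r x : ZMod c), ⟨?_, ?_⟩, ?_, ?_⟩
  · rw [continuous_iff_isClosed]
    intro s _
    have hs : (fun x => (r x : ZMod c)) ⁻¹' s =
        ⋃ b ∈ s, (T ^ (-((b.val : ℕ) : ℤ))) ⁻¹' U := by
      ext x
      simp only [Set.mem_preimage, Set.mem_iUnion, ← hiff, exists_prop]
      constructor
      · intro h; exact ⟨_, h, by simp⟩
      · rintro ⟨b, hb, h⟩
        rw [h]; simpa using hb
    rw [hs]
    exact Set.Finite.isClosed_biUnion (Set.toFinite s)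
      fun b _ => isClosed_closure.preimage (T ^ (-((b.val : ℕ) : ℤ))).continuous
  · intro x
    have := (hiff (T x) (r x + 1)).2 (by
      have h : (T ^ (-(r x + 1))) (T x) = (T ^ (-r x)) x := by
        conv_lhs => rw [← zpow_one T, ← zpow_mul, one_mul, ← zpow_add_apply]
        congr 2; ring
      rw [h]; exact hr x)
    simpa using this
  · have := (hiff z 0).2 (by simpa using mem_orbitClosure_self T m z)
    simpa using this
  · intro x y hxy
    have h1 := (hiff y (r x)).1 hxy.symm
    have h2 := orbitClosure_subset_of_mem (hz.mem_orbitClosure_symm (hr x)) h1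
    have h3 := zpow_mem_orbitClosure h2 (r x)
    rwa [zpow_apply_neg_apply, zpow_apply_neg_apply] at h3

/-- Every neighbourhood of a point in the orbit of `z` contains a height fibre through it. -/
theorem IsRegularlyRecurrent.exists_height_fibre_subset [RegularSpace X] {z : X}
    (hz : IsRegularlyRecurrent T z) (j : ℤ) {V : Set X} (hV : V ∈ 𝓝 ((T ^ j) z)) :
    ∃ d : ℕ, 0 < d ∧ ∃ f : X → ZMod d, IsHeight T d f ∧ ∀ y, f y = f ((T ^ j) z) → y ∈ V := by
  have hV' : (T ^ j) ⁻¹' V ∈ 𝓝 z := (T ^ j).continuous.continuousAt hV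
  obtain ⟨W, hW, hWc, hWV⟩ := exists_mem_nhds_isClosed_subset hV'
  obtain ⟨p, hp, hpW⟩ := hz.recurrent W hW
  obtain ⟨c, hc, -, f, hf, -, hfib⟩ := hz.exists_height hp
  refine ⟨c, hc, f, hf, fun y hy => ?_⟩
  have h1 : f z = f ((T ^ (-j)) y) := by rw [hf.map_zpow, hy, hf.map_zpow]; push_cast; ring
  have h2 := hWV (orbitClosure_subset hWc hpW (hfib _ _ h1))
  rwa [Set.mem_preimage, zpow_apply_neg_apply] at h2

/-- If `g` is constant on one fibre of `f`, then the period of `g` divides that of `f`. -/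
theorem dvd_of_height_factors {c d : ℕ} {f : X → ZMod c} {g : X → ZMod d} (hf : IsHeight T c f)
    (hg : IsHeight T d g) (x : X) (h : ∀ y, f y = f x → g y = g x) : d ∣ c := by
  have h1 := h ((T ^ (c : ℤ)) x) (by rw [hf.map_zpow]; simp)
  rw [hg.map_zpow] at h1
  simpa [ZMod.natCast_eq_zero_iff] using h1

theorem IsHeight.map_pow_of_dvd {d m : ℕ} {f : X → ZMod d} (hf : IsHeight T d f) (h : d ∣ m)
    (x : X) : f ((T ^ m) x) = f x := by
  rw [← zpow_natCast, hf.map_zpow]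
  simp [(ZMod.natCast_eq_zero_iff m d).2 h]

theorem IsRegularlyRecurrent.lcm_mem_heightPeriods [RegularSpace X] {z : X}
    (hz : IsRegularlyRecurrent T z) {d e : ℕ} (hd : d ∈ heightPeriods T)
    (he : e ∈ heightPeriods T) : d.lcm e ∈ heightPeriods T := by
  obtain ⟨hd0, f, hf⟩ := hd
  obtain ⟨he0, g, hg⟩ := he
  obtain ⟨c, hc, hcm, u, hu, -, hfib⟩ := hz.exists_height (Nat.lcm_pos hd0 he0)
  have h1 := dvd_of_height_factors hu hf z fun y hy =>
    eq_of_mem_orbitClosure hf.continuous (hf.map_pow_of_dvd (Nat.dvd_lcm_left d e))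
      (hfib _ _ hy.symm)
  have h2 := dvd_of_height_factors hu hg z fun y hy =>
    eq_of_mem_orbitClosure hg.continuous (hg.map_pow_of_dvd (Nat.dvd_lcm_right d e))
      (hfib _ _ hy.symm)
  have h3 : c = d.lcm e := Nat.dvd_antisymm hcm (Nat.lcm_dvd h1 h2)
  subst h3
  exact ⟨hc, u, hu⟩

theorem IsHeight.castHom {d e : ℕ} (h : d ∣ e) {f : X → ZMod e} (hf : IsHeight T e f) :
    IsHeight T d fun x => ZMod.castHom h (ZMod d) (f x) where
  continuous := continuous_of_discreteTopology.comp hf.continuous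
  map_apply x := by rw [hf.map_apply, map_add, map_one]

theorem mem_heightPeriods_of_dvd {d e : ℕ} (h : d ∣ e) (he : e ∈ heightPeriods T) :
    d ∈ heightPeriods T := by
  obtain ⟨he0, f, hf⟩ := he
  exact ⟨Nat.pos_of_dvd_of_pos h he0, _, hf.castHom h⟩

theorem IsRegularlyRecurrent.height_unique {z : X} (hz : IsRegularlyRecurrent T z) {d : ℕ}
    {f g : X → ZMod d} (hf : IsHeight T d f) (hg : IsHeight T d g) (h : f z = g z) : f = g := by
  refine Continuous.ext_on hz.dense hf.continuous hg.continuous ?_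
  rintro _ ⟨k, rfl⟩
  simp only [hf.map_zpow, hg.map_zpow, h]

theorem exists_normalized_height {d : ℕ} (hd : d ∈ heightPeriods T) (z : X) :
    ∃ f : X → ZMod d, IsHeight T d f ∧ f z = 0 := by
  obtain ⟨-, f, hf⟩ := hd
  refine ⟨fun x => f x - f z, ⟨?_, fun x => ?_⟩, sub_self _⟩
  · exact (continuous_of_discreteTopology (f := fun a : ZMod d => a - f z)).comp hf.continuous
  · rw [hf.map_apply]; ring

/-- A regularly recurrent system with a periodic point is finite. -/
theorem IsRegularlyRecurrent.finite_of_pow_apply_eq [T3Space X] {z : X}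
    (hz : IsRegularlyRecurrent T z) {m : ℕ} (hm : 0 < m) {x : X} (hx : (T ^ m) x = x) :
    Finite X := by
  obtain ⟨c, hc, -, f, hf, -, hfib⟩ := hz.exists_height hm
  have : NeZero c := ⟨hc.ne'⟩
  refine Finite.of_injective f fun a b hab => ?_
  -- translate both points to the fibre of the periodic point
  set k : ℤ := ((f x - f a).val : ℤ)
  have hk : ((k : ℤ) : ZMod c) = f x - f a := by simp [k]
  have hmul : ∀ l : ℤ, (T ^ ((m : ℤ) * l)) x = x := by
    intro l
    induction l with
    | zero => simp
    | succ n ih => rw [mul_add, mul_one, zpow_add_apply, zpow_natCast T m, hx, ih]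
    | pred n ih =>
      apply (T ^ m).injective
      rw [← zpow_natCast T m, ← zpow_add_apply, show (m : ℤ) + m * (-n - 1) = m * (-n) by ring, ih,
        zpow_natCast, hx]
  have key : ∀ y, f y = f x → y = x := fun y hy => by
    have := orbitClosure_subset (C := {x}) isClosed_singleton (fun l => hmul l)
      (hfib x y hy.symm)
    exact this
  have h1 := key ((T ^ k) a) (by rw [hf.map_zpow, hk]; ring)
  have h2 := key ((T ^ k) b) (by rw [hf.map_zpow, hk, ← hab]; ring)
  exact (T ^ k).injective (h1.trans h2.symm)

end Heights

/-! ### The odometer of a set of periods as the maximal equicontinuous factor -/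

/-- The scale whose `n`-th term is the least common multiple of the elements of `D` that are at
most `n`. -/
noncomputable def scaleOfPeriods (D : Set ℕ) (hD : ∀ d ∈ D, 0 < d) : OdometerScale := by
  classical exact
  { period := fun n => ((Finset.range (n + 1)).filter (· ∈ D)).lcm id
    pos := fun n => Nat.pos_of_ne_zero fun h => by
      obtain ⟨d, hd, h0⟩ := Finset.lcm_eq_zero_iff.1 h
      have h0' : d = 0 := by simpa using h0
      exact (hD d (Finset.mem_filter.1 hd).2).ne' h0'
    dvd := fun n => Finset.lcm_mono (Finset.filter_subset_filter _
      (Finset.range_subset_range.2 (Nat.le_succ _))) }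

theorem dvd_scaleOfPeriods {D : Set ℕ} {hD : ∀ d ∈ D, 0 < d} {d : ℕ} (hd : d ∈ D) :
    d ∣ (scaleOfPeriods D hD).period d := by
  classical
  exact Finset.dvd_lcm (f := id) (Finset.mem_filter.2 ⟨Finset.self_mem_range_succ d, hd⟩)

section Odometer

variable {X : Type*} [TopologicalSpace X] {T : X ≃ₜ X}

theorem one_mem_heightPeriods : 1 ∈ heightPeriods T :=
  ⟨one_pos, fun _ => 0, continuous_const, fun _ => Subsingleton.elim _ _⟩

theorem IsRegularlyRecurrent.scaleOfPeriods_mem [RegularSpace X] {z : X}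
    (hz : IsRegularlyRecurrent T z) {hD : ∀ d ∈ heightPeriods T, 0 < d} (n : ℕ) :
    (scaleOfPeriods (heightPeriods T) hD).period n ∈ heightPeriods T := by
  classical
  change ((Finset.range (n + 1)).filter (· ∈ heightPeriods T)).lcm id ∈ heightPeriods T
  have : ∀ s : Finset ℕ, (∀ d ∈ s, d ∈ heightPeriods T) → s.lcm id ∈ heightPeriods T := by
    intro s
    induction s using Finset.induction_on with
    | empty => intro _; simpa using one_mem_heightPeriods
    | insert a s _ ih =>
      intro h
      rw [Finset.lcm_insert]
      exact hz.lcm_mem_heightPeriods (h a (Finset.mem_insert_self _ _))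
        (ih fun d hd => h d (Finset.mem_insert_of_mem hd))
  exact this _ fun d hd => (Finset.mem_filter.1 hd).2

theorem odometerHomeo_zpow_apply (s : OdometerScale) (k : ℤ) (w : Odometer s) (n : ℕ) :
    ((odometerHomeo s ^ k) w).1 n = w.1 n + k := by
  have hf : IsHeight (odometerHomeo s) (s.period n) fun w => w.1 n :=
    ⟨(continuous_apply n).comp continuous_subtype_val, fun _ => rfl⟩
  exact hf.map_zpow k w

theorem isEquicontinuousSystem_odometerHomeo (s : OdometerScale) :
    IsEquicontinuousSystem (odometerHomeo s) := by
  let _ : UniformSpace (Odometer s) := uniformSpaceOfCompactR1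
  change Equicontinuous fun (n : ℤ) (y : Odometer s) => (odometerHomeo s ^ n) y
  let D : ℕ → Set (Odometer s × Odometer s) := fun n => {p | p.1.1 n = p.2.1 n}
  have hcont : ∀ n, Continuous fun w : Odometer s => w.1 n := fun n =>
    (continuous_apply n).comp continuous_subtype_val
  have hDc : ∀ n, IsClosed (D n) := fun n =>
    isClosed_eq ((hcont n).comp continuous_fst) ((hcont n).comp continuous_snd)
  have hD : Antitone D := antitone_nat_of_succ_le fun n p hp => by
    have hp' : p.1.1 (n + 1) = p.2.1 (n + 1) := hp
    change p.1.1 n = p.2.1 n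
    rw [← p.1.2 n, ← p.2.2 n, hp']
  intro w E hE
  -- by compactness, agreement in a single coordinate forces two points to be `E`-close
  obtain ⟨n, hn⟩ : ∃ n, D n ⊆ E := by
    refine exists_subset_nhds_of_compactSpace hD.directed_ge hDc fun p hp => ?_
    have hp' : p.1 = p.2 := Subtype.ext (funext fun n => Set.mem_iInter.1 hp n)
    have hE' : E ∈ 𝓝ˢ (Set.diagonal (Odometer s)) := by rwa [nhdsSet_diagonal_eq_uniformity]
    exact mem_nhdsSet_iff_forall.1 hE' p hp'
  filter_upwards [((isOpen_discrete {w.1 n}).preimage (hcont n)).mem_nhds rfl] with v hv k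
  refine hn ?_
  have hv' : v.1 n = w.1 n := hv
  change ((odometerHomeo s ^ k) w).1 n = ((odometerHomeo s ^ k) v).1 n
  rw [odometerHomeo_zpow_apply, odometerHomeo_zpow_apply, hv']

/-- Two points with the same image in the odometer have the same image in each equicontinuous
factor: some iterate brings both of them close to the regularly recurrent point. -/
theorem IsRegularlyRecurrent.apply_eq_of_height_eq [RegularSpace X] {z : X}
    (hz : IsRegularlyRecurrent T z) {W : Type*} [TopologicalSpace W] [CompactSpace W]
    [TopologicalSpace.MetrizableSpace W] {Q : W ≃ₜ W} {ψ : X → W} (hQ : IsEquicontinuousSystem Q)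
    (hψ : IsFactorMap T Q ψ) {x y : X}
    (h : ∀ d f, 0 < d → IsHeight T d f → f x = f y) : ψ x = ψ y := by
  let _ : UniformSpace W := uniformSpaceOfCompactR1
  have hQ' : Equicontinuous fun (n : ℤ) (y : W) => (Q ^ n) y := hQ
  have hpow : ∀ (k : ℤ) (x : X), ψ ((T ^ k) x) = (Q ^ k) (ψ x) := by
    intro k
    induction k with
    | zero => simp
    | succ n ih =>
      intro x
      rw [zpow_add_apply, zpow_add_apply, ih, zpow_one, zpow_one, hψ.equivariant]
    | pred n ih =>
      intro x
      have h1 := ih ((T ^ (-1 : ℤ)) x)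
      have h2 := hψ.equivariant ((T ^ (-1 : ℤ)) x)
      rw [← zpow_add_apply] at h1
      rw [sub_eq_add_neg, h1, zpow_add_apply]
      congr 1
      apply Q.injective
      rw [← h2]
      have h3 := zpow_apply_neg_apply T 1 x
      have h4 := zpow_apply_neg_apply Q 1 (ψ x)
      rw [zpow_one] at h3 h4
      rw [h3, h4]
  refine eq_of_forall_symmetric fun {E} hE _ => ?_
  obtain ⟨E', hE', hsymm, hcomp⟩ := comp_symm_mem_uniformity_sets hE
  have hN := hQ' (ψ z) E' hE'
  have hO := hψ.continuous.continuousAt.eventually hN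
  obtain ⟨d, hd, f, hf, hfib⟩ := hz.exists_height_fibre_subset 0 (V := {x | ∀ n : ℤ,
    ((Q ^ n) (ψ z), (Q ^ n) (ψ x)) ∈ E'}) (by rw [zpow_zero]; exact hO)
  have : NeZero d := ⟨hd.ne'⟩
  set k : ℤ := ((f z - f x).val : ℤ)
  have hk : ((k : ℤ) : ZMod d) = f z - f x := by simp [k]
  have h1 := hfib ((T ^ k) x) (by rw [hf.map_zpow, hk]; simp) (-k)
  have h2 := hfib ((T ^ k) y) (by rw [hf.map_zpow, ← h d f hd hf, hk]; simp) (-k)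
  rw [hpow, zpow_neg_apply_apply] at h1 h2
  exact hcomp ⟨_, hsymm.symm _ _ h1, h2⟩

/-- The heights that vanish at `z` form a factor map onto the odometer whose scale is cofinal in the
set of height periods, and its fibres are the joint fibres of all heights. -/
theorem IsRegularlyRecurrent.exists_factorMap [RegularSpace X] [CompactSpace X] {z : X}
    (hz : IsRegularlyRecurrent T z) (s : OdometerScale)
    (hs : ∀ n, s.period n ∈ heightPeriods T) (hs' : ∀ d ∈ heightPeriods T, ∃ n, d ∣ s.period n) :
    ∃ π : X → Odometer s, IsFactorMap T (odometerHomeo s) π ∧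
      ∀ x y, π x = π y → ∀ d f, 0 < d → IsHeight T d f → f x = f y := by
  choose f hf hf0 using fun n => exists_normalized_height (hs n) z
  have hcompat : ∀ n, (fun x => ZMod.castHom (s.dvd n) (ZMod (s.period n)) (f (n + 1) x)) = f n :=
    fun n => hz.height_unique ((hf (n + 1)).castHom (s.dvd n)) (hf n) (by simp only [hf0, map_zero])
  let π : X → Odometer s := fun x => ⟨fun n => f n x, fun n => congrFun (hcompat n) x⟩
  have hπ : Continuous π :=
    Continuous.subtype_mk (continuous_pi fun n => (hf n).continuous) _
  refine ⟨π, ⟨hπ, ?_, fun x => ?_⟩, ?_⟩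
  · intro w
    have hne : (⋂ n, f n ⁻¹' {w.1 n}).Nonempty := by
      refine IsCompact.nonempty_iInter_of_sequence_nonempty_isCompact_isClosed _ (fun n x hx => ?_)
        (fun n => ?_) ?_ fun n => isClosed_singleton.preimage (hf n).continuous
      · have hx' : f (n + 1) x = w.1 (n + 1) := hx
        change f n x = w.1 n
        rw [← hcompat n, ← w.2 n]
        exact congrArg _ hx'
      · have : NeZero (s.period n) := ⟨(s.pos n).ne'⟩
        exact ⟨(T ^ ((w.1 n).val : ℤ)) z, by simp [(hf n).map_zpow, hf0]⟩
      · exact (isClosed_singleton.preimage (hf 0).continuous).isCompact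
    obtain ⟨x, hx⟩ := hne
    exact ⟨x, Subtype.ext (funext fun n => Set.mem_iInter.1 hx n)⟩
  · exact Subtype.ext (funext fun n => (hf n).map_apply x)
  · intro x y hxy d g hd hg
    obtain ⟨n, hn⟩ := hs' d ⟨hd, g, hg⟩
    have h1 : f n x = f n y := congrFun (congrArg Subtype.val hxy) n
    have h2 : (fun x => ZMod.castHom hn (ZMod d) (f n x)) = fun x => g x - g z := by
      refine hz.height_unique ((hf n).castHom hn) ⟨?_, fun x => ?_⟩ (by simp [hf0])
      · exact (continuous_of_discreteTopology (f := fun a : ZMod d => a - g z)).comp hg.continuous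
      · rw [hg.map_apply]; ring
    have h3 := congrFun h2 x
    have h4 := congrFun h2 y
    simp only [h1] at h3 h4
    exact sub_left_injective (h3.symm.trans h4)

/-- The odometer whose scale is cofinal in the set of height periods is the maximal equicontinuous
factor of a regularly recurrent system. -/
theorem IsRegularlyRecurrent.isMaximalEquicontinuousFactor.{u, w} {X : Type u} [TopologicalSpace X]
    {T : X ≃ₜ X} [RegularSpace X] [CompactSpace X] {z : X}
    (hz : IsRegularlyRecurrent T z) (s : OdometerScale)
    (hs : ∀ n, s.period n ∈ heightPeriods T) (hs' : ∀ d ∈ heightPeriods T, ∃ n, d ∣ s.period n) :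
    IsMaximalEquicontinuousFactor.{u, 0, w} T (odometerHomeo s) := by
  obtain ⟨π, hπ, hfib⟩ := hz.exists_factorMap s hs hs'
  refine ⟨isEquicontinuousSystem_odometerHomeo s, π, hπ, fun W _ _ _ Q ψ hQ hψ => ?_⟩
  have hψπ : ∀ x y, π x = π y → ψ x = ψ y := fun x y h =>
    hz.apply_eq_of_height_eq hQ hψ (hfib x y h)
  have hquot : IsQuotientMap π := hπ.continuous.isClosedMap.isQuotientMap hπ.continuous hπ.surjective
  let θ : Odometer s → W := fun w => ψ (Function.surjInv hπ.surjective w)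
  have hθ : ∀ x, ψ x = θ (π x) := fun x =>
    hψπ _ _ (Function.surjInv_eq hπ.surjective (π x)).symm
  refine ⟨θ, ⟨?_, ?_, ?_⟩, hθ⟩
  · rw [hquot.continuous_iff]
    exact hψ.continuous.congr hθ
  · intro w
    obtain ⟨x, rfl⟩ := hψ.surjective w
    exact ⟨π x, (hθ x).symm⟩
  · intro w
    obtain ⟨x, rfl⟩ := hπ.surjective w
    rw [← hπ.equivariant, ← hθ, ← hθ, hψ.equivariant]

/-- A regularly recurrent system is finite if its odometer is: the fibre through the regularly
recurrent point is a singleton, and it is open. -/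
theorem IsRegularlyRecurrent.infinite_odometer [T3Space X] [CompactSpace X] [Infinite X] {z : X}
    (hz : IsRegularlyRecurrent T z) (s : OdometerScale)
    (hs : ∀ n, s.period n ∈ heightPeriods T) (hs' : ∀ d ∈ heightPeriods T, ∃ n, d ∣ s.period n) :
    Infinite (Odometer s) := by
  obtain ⟨π, hπ, hfib⟩ := hz.exists_factorMap s hs hs'
  by_contra hfin
  rw [not_infinite_iff_finite] at hfin
  have hopen : IsOpen (π ⁻¹' {π z}) := (isOpen_discrete _).preimage hπ.continuous
  have hsing : π ⁻¹' {π z} ⊆ {z} := by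
    intro x hx
    by_contra hne
    obtain ⟨d, hd, f, hf, hV⟩ := hz.exists_height_fibre_subset 0 (V := {x}ᶜ)
      (isOpen_compl_singleton.mem_nhds (by simpa using fun h => hne h.symm))
    exact hV x (by simpa using hfib x z hx d f hd hf) rfl
  obtain ⟨p, hp, hpV⟩ := hz.recurrent _ (hopen.mem_nhds rfl)
  have h1 : (T ^ p) z = z := by simpa using hsing (hpV 1)
  have := hz.finite_of_pow_apply_eq hp h1
  exact not_finite X

end Odometer

/-! ### Localizing homeomorphisms to periodic clopen sets -/

section Localize

variable {X : Type*} [TopologicalSpace X] {T : X ≃ₜ X}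

open Classical in
/-- The homeomorphism that agrees with `φ` on the `φ`-invariant clopen set `V` and is the identity
elsewhere. -/
noncomputable def localize (φ : X ≃ₜ X) (V : Set X) (hV : IsClopen V)
    (h : ∀ x, φ x ∈ V ↔ x ∈ V) : X ≃ₜ X where
  toFun x := if x ∈ V then φ x else x
  invFun x := if x ∈ V then φ.symm x else x
  left_inv x := by
    by_cases hx : x ∈ V
    · simp [hx, h]
    · simp [hx]
  right_inv x := by
    by_cases hx : x ∈ V
    · have : φ.symm x ∈ V := by rw [← h]; simpa using hx
      simp [hx, this]
    · simp [hx]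
  continuous_toFun := by
    refine continuous_if (fun a ha => ?_) φ.continuous.continuousOn continuous_id.continuousOn
    have : a ∈ frontier V := ha
    rw [hV.frontier_eq] at this
    exact this.elim
  continuous_invFun := by
    refine continuous_if (fun a ha => ?_) φ.symm.continuous.continuousOn continuous_id.continuousOn
    have : a ∈ frontier V := ha
    rw [hV.frontier_eq] at this
    exact this.elim

section

variable {φ ψ : X ≃ₜ X} {V : Set X} {hV : IsClopen V} {h : ∀ x, φ x ∈ V ↔ x ∈ V}

theorem localize_apply_of_mem {x : X} (hx : x ∈ V) : localize φ V hV h x = φ x :=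
  if_pos hx

theorem localize_apply_of_notMem {x : X} (hx : x ∉ V) : localize φ V hV h x = x :=
  if_neg hx

theorem localize_apply_mem_iff {W : Set X} (hW : ∀ x, φ x ∈ W ↔ x ∈ W) (x : X) :
    localize φ V hV h x ∈ W ↔ x ∈ W := by
  by_cases hx : x ∈ V
  · rw [localize_apply_of_mem hx, hW]
  · rw [localize_apply_of_notMem hx]

theorem inv_apply_mem_iff {φ : X ≃ₜ X} {V : Set X} (h : ∀ x, φ x ∈ V ↔ x ∈ V) (x : X) :
    φ⁻¹ x ∈ V ↔ x ∈ V := by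
  rw [← h, ← Homeomorph.mul_apply, mul_inv_cancel]; rfl

theorem inv_localize_apply_of_notMem {x : X} (hx : x ∉ V) : (localize φ V hV h)⁻¹ x = x :=
  if_neg hx

theorem inv_localize_apply_of_mem {x : X} (hx : x ∈ V) : (localize φ V hV h)⁻¹ x = φ⁻¹ x :=
  if_pos hx

theorem commute_localize (hc : Commute ψ φ) (hψ : ∀ x, ψ x ∈ V ↔ x ∈ V) :
    Commute ψ (localize φ V hV h) := by
  ext x
  simp only [Homeomorph.mul_apply]
  by_cases hx : x ∈ V
  · rw [localize_apply_of_mem hx, localize_apply_of_mem ((hψ x).2 hx)]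
    exact DFunLike.congr_fun hc x
  · rw [localize_apply_of_notMem hx, localize_apply_of_notMem (mt (hψ x).1 hx)]

theorem commute_localize_localize {W : Set X} {hW : IsClopen W} {h' : ∀ x, φ x ∈ W ↔ x ∈ W} :
    Commute (localize φ V hV h) (localize φ W hW h') :=
  commute_localize (commute_localize (Commute.refl φ) h).symm (localize_apply_mem_iff h')

theorem apply_comm {f g : X ≃ₜ X} (hc : Commute f g) (x : X) : f (g x) = g (f x) :=
  DFunLike.congr_fun hc x

theorem pow_add_apply (φ : X ≃ₜ X) (i j : ℕ) (x : X) : (φ ^ (i + j)) x = (φ ^ i) ((φ ^ j) x) := by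
  rw [pow_add]; rfl

theorem conj_localize {b : X ≃ₜ X} (hb : Commute b φ) :
    b * localize φ V hV h * b⁻¹ = localize φ (b.symm ⁻¹' V) (hV.preimage b.symm.continuous)
      (fun x => (iff_of_eq (congrArg (· ∈ V) (apply_comm hb.inv_left x))).trans (h _)) := by
  rw [mul_inv_eq_iff_eq_mul]
  ext x
  have hx' : b.symm (b x) = x := b.symm_apply_apply x
  simp only [Homeomorph.mul_apply]
  by_cases hx : x ∈ V
  · rw [localize_apply_of_mem hx, localize_apply_of_mem (by rwa [Set.mem_preimage, hx']),
      apply_comm hb]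
  · rw [localize_apply_of_notMem hx, localize_apply_of_notMem (by rwa [Set.mem_preimage, hx'])]

end

/-- A clopen set that is invariant under some power `T ^ m`, `m ≥ 1`. -/
structure IsPeriodicClopen (T : X ≃ₜ X) (V : Set X) : Prop where
  isClopen : IsClopen V
  exists_pow : ∃ m : ℕ, 0 < m ∧ ∀ x, (T ^ m) x ∈ V ↔ x ∈ V

theorem pow_mul_apply_mem_iff {φ : X ≃ₜ X} {V : Set X} {m : ℕ} (h : ∀ x, (φ ^ m) x ∈ V ↔ x ∈ V)
    (k : ℕ) (x : X) : (φ ^ (m * k)) x ∈ V ↔ x ∈ V := by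
  induction k with
  | zero => simp
  | succ k ih => rw [mul_add, mul_one, add_comm, pow_add, Homeomorph.mul_apply, h, ih]

theorem mem_stabilizedAut_iff {φ : X ≃ₜ X} :
    φ ∈ stabilizedAut T ↔ ∃ n : ℕ, 0 < n ∧ Commute φ (T ^ n) := Iff.rfl

theorem IsPeriodicClopen.localize_mem {V : Set X} (hV : IsPeriodicClopen T V) {φ : X ≃ₜ X}
    (hφ : φ ∈ stabilizedAut T) (h : ∀ x, φ x ∈ V ↔ x ∈ V) :
    localize φ V hV.isClopen h ∈ stabilizedAut T := by
  obtain ⟨n, hn, hc⟩ := mem_stabilizedAut_iff.1 hφ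
  obtain ⟨m, hm, hT⟩ := hV.exists_pow
  refine mem_stabilizedAut_iff.2 ⟨m * n, Nat.mul_pos hm hn, ?_⟩
  refine (commute_localize ?_ (pow_mul_apply_mem_iff hT n)).symm
  rw [mul_comm, pow_mul]
  exact (hc.pow_right m).symm

theorem IsPeriodicClopen.preimage {V : Set X} (hV : IsPeriodicClopen T V) {φ : X ≃ₜ X}
    (hφ : φ ∈ stabilizedAut T) : IsPeriodicClopen T (φ ⁻¹' V) := by
  obtain ⟨n, hn, hc⟩ := mem_stabilizedAut_iff.1 hφ
  obtain ⟨m, hm, hT⟩ := hV.exists_pow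
  refine ⟨hV.isClopen.preimage φ.continuous, m * n, Nat.mul_pos hm hn, fun x => ?_⟩
  have hc' : Commute φ (T ^ (m * n)) := by rw [mul_comm, pow_mul]; exact hc.pow_right m
  rw [Set.mem_preimage, apply_comm hc', pow_mul_apply_mem_iff hT, Set.mem_preimage]

theorem IsPeriodicClopen.union {V W : Set X} (hV : IsPeriodicClopen T V)
    (hW : IsPeriodicClopen T W) : IsPeriodicClopen T (V ∪ W) := by
  obtain ⟨m, hm, hT⟩ := hV.exists_pow
  obtain ⟨n, hn, hS⟩ := hW.exists_pow
  refine ⟨hV.isClopen.union hW.isClopen, m * n, Nat.mul_pos hm hn, fun x => ?_⟩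
  rw [Set.mem_union, pow_mul_apply_mem_iff hT, mul_comm, pow_mul_apply_mem_iff hS, Set.mem_union]

theorem isPeriodicClopen_empty : IsPeriodicClopen T ∅ :=
  ⟨isClopen_empty, 1, one_pos, fun _ => Iff.rfl⟩

theorem IsHeight.isPeriodicClopen_fibre {d : ℕ} (hd : 0 < d) {f : X → ZMod d}
    (hf : IsHeight T d f) (a : ZMod d) : IsPeriodicClopen T (f ⁻¹' {a}) :=
  ⟨(isClopen_discrete _).preimage hf.continuous, d, hd, fun x => by
    rw [Set.mem_preimage, hf.map_pow_of_dvd dvd_rfl, Set.mem_preimage]⟩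

/-- The union of the translates of a periodic clopen set under a finite-order element. -/
theorem IsPeriodicClopen.saturation {V : Set X} (hV : IsPeriodicClopen T V) {h : X ≃ₜ X}
    (hh : h ∈ stabilizedAut T) {n : ℕ} (hn : 0 < n) (hpow : h ^ n = 1) :
    IsPeriodicClopen T {x | ∃ j : ℕ, (h ^ j) x ∈ V} ∧
      ∀ x, h x ∈ {x | ∃ j : ℕ, (h ^ j) x ∈ V} ↔ x ∈ {x | ∃ j : ℕ, (h ^ j) x ∈ V} := by
  constructor
  · have hper : ∀ k, IsPeriodicClopen T {x | ∃ j < k, (h ^ j) x ∈ V} := by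
      intro k
      induction k with
      | zero => simpa using isPeriodicClopen_empty
      | succ k ih =>
        have : {x | ∃ j < k + 1, (h ^ j) x ∈ V} = {x | ∃ j < k, (h ^ j) x ∈ V} ∪ (h ^ k) ⁻¹' V := by
          ext x
          simp only [Set.mem_ofPred_eq, Set.mem_union, Set.mem_preimage, Nat.lt_succ_iff_lt_or_eq]
          constructor
          · rintro ⟨j, hj | rfl, hx⟩
            · exact Or.inl ⟨j, hj, hx⟩
            · exact Or.inr hx
          · rintro (⟨j, hj, hx⟩ | hx)
            · exact ⟨j, Or.inl hj, hx⟩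
            · exact ⟨k, Or.inr rfl, hx⟩
        rw [this]
        exact ih.union (hV.preimage (Subgroup.pow_mem _ hh k))
    convert hper n using 1
    ext x
    refine ⟨fun ⟨j, hj⟩ => ⟨j % n, Nat.mod_lt _ hn, ?_⟩, fun ⟨j, _, hj⟩ => ⟨j, hj⟩⟩
    rwa [← pow_mod_orderOf, Nat.mod_mod_of_dvd _ (orderOf_dvd_of_pow_eq_one hpow), pow_mod_orderOf]
  · intro x
    constructor
    · rintro ⟨j, hj⟩
      exact ⟨j + 1, by rwa [pow_succ]⟩
    · rintro ⟨j, hj⟩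
      refine ⟨j + n - 1, ?_⟩
      rw [← Homeomorph.mul_apply, ← pow_succ, Nat.sub_add_cancel (by omega), pow_add, hpow, mul_one]
      exact hj

end Localize

/-! ### An algebraic form of freeness -/

/-- A purely group-theoretic condition which, in the stabilized automorphism group of an infinite
regularly recurrent system, holds for fixed-point-free elements of finite order and fails for
elements that are the identity on a nonempty periodic clopen set: each nontrivial `f` in the
centralizer of `h` is, or has a commutator with an element of the centralizer that is, a nontrivial
element commuting with all its conjugates under the centralizer. -/
def IsAlgebraicallyFree {Γ : Type*} [Group Γ] (h : Γ) : Prop :=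
  ∀ f, Commute f h → f ≠ 1 → ∃ c, c ≠ 1 ∧ (c = f ∨ ∃ a, Commute a h ∧ c = ⁅f, a⁆) ∧
    ∀ b, Commute b h → Commute (b * c * b⁻¹) c

theorem IsAlgebraicallyFree.map {Γ Δ : Type*} [Group Γ] [Group Δ] (e : Γ ≃* Δ) {h : Γ}
    (hh : IsAlgebraicallyFree h) : IsAlgebraicallyFree (e h) := by
  have hcomm : ∀ {b : Δ}, Commute b (e h) → Commute (e.symm b) h := fun {b} hb => by
    simpa using hb.map e.symm
  intro f hf hf1
  obtain ⟨c, hc1, hc, hcb⟩ := hh (e.symm f) (hcomm hf) (by simpa using hf1)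
  refine ⟨e c, by simpa using hc1, ?_, fun b hb => ?_⟩
  · rcases hc with rfl | ⟨a, ha, rfl⟩
    · exact Or.inl (by simp)
    · exact Or.inr ⟨e a, ha.map e, by simp [map_commutatorElement]⟩
  · simpa using (hcb _ (hcomm hb)).map e

/-- If the conjugates of `a` under a subgroup commute with each other, then so do the conjugates of
a commutator `⁅f, a⁆` with `f` in the subgroup. -/
theorem commute_conj_commutator {Γ : Type*} [Group Γ] {H : Subgroup Γ} {a f : Γ} (hf : f ∈ H)
    (ha : ∀ u ∈ H, ∀ v ∈ H, Commute (u * a * u⁻¹) (v * a * v⁻¹)) {b : Γ} (hb : b ∈ H) :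
    Commute (b * ⁅f, a⁆ * b⁻¹) ⁅f, a⁆ := by
  have h1 : b * ⁅f, a⁆ * b⁻¹ = (b * f * a * (b * f)⁻¹) * (b * a * b⁻¹)⁻¹ := by
    rw [commutatorElement_def]; group
  have h2 : ⁅f, a⁆ = (f * a * f⁻¹) * (1 * a * 1⁻¹)⁻¹ := by rw [commutatorElement_def]; group
  rw [h1, h2]
  have hbf := H.mul_mem hb hf
  have h1 := H.one_mem
  exact ((ha _ hbf _ hf).mul_right (ha _ hbf _ h1).inv_right).mul_left
    ((ha _ hb _ hf).mul_right (ha _ hb _ h1).inv_right).inv_left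

section Free

variable {X : Type*} [TopologicalSpace X] {T : X ≃ₜ X} {z : X}

/-- If `f` preserves all `h`-invariant periodic clopen sets, where `h` has finite order, then `f`
moves each point of the distinguished orbit within its `h`-orbit. -/
theorem IsRegularlyRecurrent.exists_apply_eq_pow [T3Space X] (hz : IsRegularlyRecurrent T z)
    {h f : X ≃ₜ X} (hh : h ∈ stabilizedAut T) {n : ℕ} (hn : 0 < n) (hpow : h ^ n = 1)
    (hf : ∀ V, IsPeriodicClopen T V → (∀ x, h x ∈ V ↔ x ∈ V) → ∀ x, f x ∈ V ↔ x ∈ V) (k : ℤ) :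
    ∃ j : ℕ, f ((T ^ k) z) = (h ^ j) ((T ^ k) z) := by
  set x := (T ^ k) z
  by_contra! hne
  have hfin : {y | ∃ j : ℕ, (h ^ j) (f x) = y}.Finite := by
    refine (Set.Finite.image (fun j : ℕ => (h ^ j) (f x)) (Set.finite_lt_nat n)).subset ?_
    rintro _ ⟨j, rfl⟩
    exact ⟨j % n, Nat.mod_lt _ hn, by
      change (h ^ (j % n)) (f x) = _
      rw [← pow_mod_orderOf, Nat.mod_mod_of_dvd _ (orderOf_dvd_of_pow_eq_one hpow),
        pow_mod_orderOf]⟩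
  have hx : x ∉ {y | ∃ j : ℕ, (h ^ j) (f x) = y} := by
    rintro ⟨j, hj⟩
    refine hne (n * j - j) ?_
    conv_rhs => rw [← hj]
    rw [← pow_add_apply, Nat.sub_add_cancel (Nat.le_mul_of_pos_left j hn), pow_mul, hpow, one_pow]
    rfl
  obtain ⟨d, hd, g, hg, hV⟩ := hz.exists_height_fibre_subset k
    (hfin.isClosed.isOpen_compl.mem_nhds hx)
  obtain ⟨h1, h2⟩ := (hg.isPeriodicClopen_fibre hd (g x)).saturation hh hn hpow
  obtain ⟨j, hj⟩ := (hf _ h1 h2 x).2 ⟨0, by simp⟩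
  exact hV _ hj ⟨j, rfl⟩

theorem IsRegularlyRecurrent.isAlgebraicallyFree_of_fixedPointFree [T3Space X]
    (hz : IsRegularlyRecurrent T z) {h : stabilizedAut T} {n : ℕ} (hn : 0 < n) (hpow : h ^ n = 1)
    (hfix : ∀ x, h.1 x ≠ x) : IsAlgebraicallyFree h := by
  have hpow' : h.1 ^ n = 1 := congrArg Subtype.val hpow
  have hcoe : ∀ {a b : stabilizedAut T}, Commute a b → Commute a.1 b.1 :=
    fun hab => congrArg Subtype.val hab
  intro f hf hf1
  by_cases hinv : ∀ V, IsPeriodicClopen T V → (∀ x, h.1 x ∈ V ↔ x ∈ V) → ∀ x, f.1 x ∈ V ↔ x ∈ V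
  · refine ⟨f, hf1, Or.inl rfl, fun b hb => ?_⟩
    set f' := b * f * b⁻¹ with hf'
    have hf'h : Commute f' h := (hb.mul_left hf).mul_left hb.inv_left
    have hinv' : ∀ V, IsPeriodicClopen T V → (∀ x, h.1 x ∈ V ↔ x ∈ V) →
        ∀ x, f'.1 x ∈ V ↔ x ∈ V := by
      intro V hV hVh x
      have h1 := hinv (b.1 ⁻¹' V) (hV.preimage b.2)
        (fun y => by rw [Set.mem_preimage, apply_comm (hcoe hb), hVh]; rfl) (b.1⁻¹ x)
      have h2 : b.1 (b.1⁻¹ x) = x := b.1.apply_symm_apply x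
      rw [Set.mem_preimage, Set.mem_preimage, h2] at h1
      exact h1
    apply Subtype.ext
    refine Homeomorph.ext (congrFun (Continuous.ext_on hz.dense (f' * f).1.continuous
      (f * f').1.continuous ?_))
    rintro _ ⟨k, rfl⟩
    obtain ⟨i, hi⟩ := hz.exists_apply_eq_pow h.2 hn hpow' hinv k
    obtain ⟨j, hj⟩ := hz.exists_apply_eq_pow h.2 hn hpow' hinv' k
    change f'.1 (f.1 ((T ^ k) z)) = f.1 (f'.1 ((T ^ k) z))
    rw [hi, apply_comm ((hcoe hf'h).pow_right i), hj, apply_comm ((hcoe hf).pow_right j), hi,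
      ← pow_add_apply, ← pow_add_apply, add_comm]
  · push Not at hinv
    obtain ⟨V, hV, hVh, x, hx⟩ := hinv
    let a : stabilizedAut T := ⟨localize h.1 V hV.isClopen hVh, hV.localize_mem h.2 hVh⟩
    have hah : Commute a h := 
      Subtype.ext (commute_localize (h := hVh) (hV := hV.isClopen) (Commute.refl h.1) hVh).symm
    refine ⟨⁅f, a⁆, ?_, Or.inr ⟨a, hah, rfl⟩, fun b hb => ?_⟩
    · rw [Ne, commutatorElement_eq_one_iff_mul_comm]
      intro hc
      -- the localization of `h` to `V` and to its image under `f` differ at `f x`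
      have h1 : f.1 (a.1 x) = a.1 (f.1 x) := apply_comm (hcoe hc) x
      rcases hx with ⟨hfx, hxV⟩ | ⟨hfx, hxV⟩
      · rw [localize_apply_of_notMem hxV, localize_apply_of_mem hfx] at h1
        exact hfix _ h1.symm
      · rw [localize_apply_of_mem hxV, localize_apply_of_notMem hfx] at h1
        exact hfix _ (f.1.injective h1)
    · refine commute_conj_commutator (H := Subgroup.centralizer {h})
        (Subgroup.mem_centralizer_singleton_iff.2 hf) ?_
        (Subgroup.mem_centralizer_singleton_iff.2 hb)
      intro u hu v hv
      have hu' : Commute u h := Subgroup.mem_centralizer_singleton_iff.1 hu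
      have hv' : Commute v h := Subgroup.mem_centralizer_singleton_iff.1 hv
      apply Subtype.ext
      change (u.1 * localize h.1 V hV.isClopen hVh * u.1⁻¹) *
        (v.1 * localize h.1 V hV.isClopen hVh * v.1⁻¹) =
        (v.1 * localize h.1 V hV.isClopen hVh * v.1⁻¹) *
        (u.1 * localize h.1 V hV.isClopen hVh * u.1⁻¹)
      rw [conj_localize (hcoe hu'), conj_localize (hcoe hv')]
      exact commute_localize_localize

end Free

/-! ### Recovering the height periods from the group -/

section Recover

variable {X : Type*} [TopologicalSpace X] {T : X ≃ₜ X} {z : X}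

/-- An element `h` that is the identity on a nonempty periodic clopen set `V` is not algebraically
free: if `f` is the restriction of a power of `T` to `V`, then the element `c` that algebraic
freeness provides is supported where `h` is the identity, and it fails to commute with some
conjugate of itself. -/
theorem IsRegularlyRecurrent.not_isAlgebraicallyFree [T3Space X] [Infinite X]
    (hz : IsRegularlyRecurrent T z) {h : stabilizedAut T} {V : Set X} (hV : IsPeriodicClopen T V)
    (hne : V.Nonempty) (hid : ∀ x ∈ V, h.1 x = x) : ¬ IsAlgebraicallyFree h := by
  intro hfree
  have haper : ∀ {m : ℕ} (x : X), 0 < m → (T ^ m) x ≠ x := fun x hm hx =>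
    not_finite_iff_infinite.2 ‹_› (hz.finite_of_pow_apply_eq hm hx)
  have hcoe : ∀ {a b : stabilizedAut T}, Commute a b → Commute a.1 b.1 :=
    fun hab => congrArg Subtype.val hab
  have hTmem : ∀ m : ℕ, T ^ m ∈ stabilizedAut T := fun m =>
    mem_stabilizedAut_iff.2 ⟨1, one_pos, by rw [pow_one]; exact (Commute.refl T).pow_left m⟩
  -- an element fixing all points off a set on which `h` is the identity commutes with `h`
  have hcomm : ∀ {W : Set X} (hW : IsClopen W) {m : ℕ} (hm : ∀ x, (T ^ m) x ∈ W ↔ x ∈ W),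
      (∀ x ∈ W, h.1 x = x) → Commute (localize (T ^ m) W hW hm) h.1 := by
    intro W hW m hm hidW
    ext x
    have hWh : h.1 x ∈ W ↔ x ∈ W :=
      ⟨fun hx => by rwa [h.1.injective (hidW _ hx)] at hx, fun hx => by rwa [hidW x hx]⟩
    simp only [Homeomorph.mul_apply]
    by_cases hx : x ∈ W
    · rw [hidW x hx, localize_apply_of_mem hx, hidW _ ((hm x).2 hx)]
    · rw [localize_apply_of_notMem hx, localize_apply_of_notMem (mt hWh.1 hx)]
  obtain ⟨m, hm, hT⟩ := hV.exists_pow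
  let f : stabilizedAut T := ⟨localize (T ^ m) V hV.isClopen hT, hV.localize_mem (hTmem m) hT⟩
  have hfh : Commute f h := Subtype.ext (hcomm hV.isClopen hT hid)
  have hf1 : f ≠ 1 := by
    intro hf
    obtain ⟨x, hx⟩ := hne
    have h1 : f.1 x = x := by rw [hf]; rfl
    rw [localize_apply_of_mem hx] at h1
    exact haper x hm h1
  obtain ⟨c, hc1, hc, hcb⟩ := hfree f hfh hf1
  have hfsupp : ∀ x, h.1 x ≠ x → f.1 x = x := fun x hx =>
    localize_apply_of_notMem (hV := hV.isClopen) (h := hT) fun hxV => hx (hid x hxV)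
  have hcsupp : ∀ x, h.1 x ≠ x → c.1 x = x := by
    rcases hc with rfl | ⟨a, ha, rfl⟩
    · exact hfsupp
    · intro x hx
      have hax : h.1 (a.1⁻¹ x) ≠ a.1⁻¹ x := by
        rw [← apply_comm (hcoe ha).inv_left]
        exact fun he => hx (a.1⁻¹.injective he)
      have hfinv : f.1⁻¹ (a.1⁻¹ x) = a.1⁻¹ x := by
        conv_lhs => rw [← hfsupp _ hax]
        exact f.1.symm_apply_apply _
      change f.1 (a.1 (f.1⁻¹ (a.1⁻¹ x))) = x
      rw [hfinv]
      have : a.1 (a.1⁻¹ x) = x := a.1.apply_symm_apply x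
      rw [this, hfsupp x hx]
  -- a point of the distinguished orbit that `c` moves and `h` fixes
  obtain ⟨k, hk⟩ : ∃ k : ℤ, c.1 ((T ^ k) z) ≠ (T ^ k) z := by
    by_contra! hall
    refine hc1 (Subtype.ext (Homeomorph.ext (congrFun (Continuous.ext_on hz.dense
      c.1.continuous continuous_id ?_))))
    rintro _ ⟨k, rfl⟩
    exact hall k
  set x := (T ^ k) z
  have hhx : h.1 x = x := by
    by_contra hne'
    exact hk (hcsupp x hne')
  obtain ⟨n, hn, hTn⟩ := mem_stabilizedAut_iff.1 h.2
  obtain ⟨p, hp, -, u, hu, -, hufib⟩ := hz.exists_height hn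
  have hidu : ∀ y, u y = u x → h.1 y = y := by
    intro y hy
    have hsub : orbitClosure T n x ⊆ {y | h.1 y = y} := by
      refine orbitClosure_subset (isClosed_eq h.1.continuous continuous_id) fun l => ?_
      have hcl : Commute h.1 (T ^ ((n : ℤ) * l)) := by
        rw [zpow_mul, zpow_natCast]; exact hTn.zpow_right l
      change h.1 _ = _
      rw [apply_comm hcl, hhx]
    exact hsub (hufib x y hy.symm)
  obtain ⟨O, O', hO, hO', hxO, hxO', hdisj⟩ := t2_separation hk
  have hnhds : (O' ∩ c.1 ⁻¹' O) ∩ u ⁻¹' {u x} ∈ 𝓝 x :=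
    ((hO'.inter (hO.preimage c.1.continuous)).inter
      ((isOpen_discrete _).preimage hu.continuous)).mem_nhds ⟨⟨hxO', hxO⟩, rfl⟩
  obtain ⟨e, he, v, hv, hvfib⟩ := hz.exists_height_fibre_subset k hnhds
  have hW := hv.isPeriodicClopen_fibre he (v x)
  set W := v ⁻¹' {v x} with hWdef
  have hcW : ∀ y ∈ W, c.1 y ∉ W := fun y hy hcy =>
    Set.disjoint_left.1 hdisj (hvfib y hy).1.2 (hvfib _ hcy).1.1
  have hTe : ∀ y, (T ^ e) y ∈ W ↔ y ∈ W := fun y => by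
    simp only [hWdef, Set.mem_preimage, hv.map_pow_of_dvd dvd_rfl]
  let b : stabilizedAut T := ⟨localize (T ^ e) W hW.isClopen hTe, hW.localize_mem (hTmem e) hTe⟩
  have hbh : Commute b h :=
    Subtype.ext (hcomm hW.isClopen hTe fun y hy => hidu y (hvfib y hy).2)
  have hcbh := hcoe (hcb b hbh)
  have hxW : x ∈ W := rfl
  -- comparing both sides at `c⁻¹ x` shows that `b` and its inverse agree at `x`
  have h1 := apply_comm hcbh (c.1⁻¹ x)
  have hcx : c.1 (c.1⁻¹ x) = x := c.1.apply_symm_apply x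
  rw [hcx] at h1
  change b.1 (c.1 (b.1⁻¹ x)) = c.1 (b.1 (c.1 (b.1⁻¹ (c.1⁻¹ x)))) at h1
  have h2 : c.1⁻¹ x ∉ W := fun hmem => hcW _ hmem (by rwa [hcx])
  have h3 : b.1⁻¹ x = (T ^ e)⁻¹ x :=
    inv_localize_apply_of_mem (hV := hW.isClopen) (h := hTe) hxW
  have h4 : (T ^ e)⁻¹ x ∈ W := (inv_apply_mem_iff hTe x).2 hxW
  have h5 : b.1⁻¹ (c.1⁻¹ x) = c.1⁻¹ x :=
    inv_localize_apply_of_notMem (hV := hW.isClopen) (h := hTe) h2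
  have h6 : b.1 (c.1 ((T ^ e)⁻¹ x)) = c.1 ((T ^ e)⁻¹ x) :=
    localize_apply_of_notMem (hV := hW.isClopen) (h := hTe) (hcW _ h4)
  have h7 : b.1 x = (T ^ e) x := localize_apply_of_mem (hV := hW.isClopen) (h := hTe) hxW
  rw [h3, h5, hcx, h6, h7] at h1
  have h8 := c.1.injective h1
  refine haper (m := e + e) x (by omega) ?_
  rw [pow_add_apply, ← h8]
  exact (T ^ e).apply_symm_apply x

/-- An element of the stabilized automorphism group that is not the identity on any nonempty
periodic clopen set moves every fibre of a suitable height off itself. -/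
theorem IsRegularlyRecurrent.exists_height_apply_ne [T3Space X] (hz : IsRegularlyRecurrent T z)
    {h : X ≃ₜ X} (hh : h ∈ stabilizedAut T)
    (hid : ∀ V, IsPeriodicClopen T V → V.Nonempty → ∃ x ∈ V, h x ≠ x) :
    ∃ d : ℕ, 0 < d ∧ ∃ f : X → ZMod d, IsHeight T d f ∧ ∀ y, f (h y) ≠ f y := by
  obtain ⟨m, hm, hc⟩ := mem_stabilizedAut_iff.1 hh
  obtain ⟨p, hp, -, u, hu, -, hufib⟩ := hz.exists_height hm
  have hmove : ∀ k : ℤ, h ((T ^ k) z) ≠ (T ^ k) z := by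
    intro k hk
    obtain ⟨y, hy, hne⟩ := hid _ (hu.isPeriodicClopen_fibre hp (u ((T ^ k) z))) ⟨_, rfl⟩
    refine hne ?_
    have hsub : orbitClosure T m ((T ^ k) z) ⊆ {y | h y = y} := by
      refine orbitClosure_subset (isClosed_eq h.continuous continuous_id) fun l => ?_
      have hcl : Commute h (T ^ ((m : ℤ) * l)) := by
        rw [zpow_mul, zpow_natCast]; exact hc.zpow_right l
      change h _ = _
      rw [apply_comm hcl, hk]
    exact hsub (hufib _ y (Eq.symm hy))
  have hsep : ∀ k : ℤ, ∃ d : ℕ, 0 < d ∧ ∃ f : X → ZMod d, IsHeight T d f ∧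
      f (h ((T ^ k) z)) ≠ f ((T ^ k) z) := by
    intro k
    obtain ⟨d, hd, f, hf, hfib⟩ := hz.exists_height_fibre_subset k
      (isOpen_compl_singleton.mem_nhds (hmove k).symm)
    exact ⟨d, hd, f, hf, fun he => hfib _ he rfl⟩
  choose d hd f hf hne using hsep
  -- a height refining those that separate finitely many representatives from their images
  obtain ⟨e, he, -, v, hv, -, hvfib⟩ := hz.exists_height
    (m := ∏ j ∈ Finset.range p, d j) (Finset.prod_pos fun j _ => hd j)
  refine ⟨e, he, v, hv, fun y hy => ?_⟩
  have : NeZero p := ⟨hp.ne'⟩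
  obtain ⟨j, hj, hjy⟩ : ∃ j : ℕ, j < p ∧ u ((T ^ (j : ℤ)) z) = u y :=
    ⟨(u y - u z).val, ZMod.val_lt _, by rw [hu.map_zpow]; simp⟩
  have hdiff : v (h ((T ^ (j : ℤ)) z)) - v ((T ^ (j : ℤ)) z) = v (h y) - v y := by
    refine eq_of_mem_orbitClosure (T := T) (m := m) (F := fun x => v (h x) - v x)
      ((hv.continuous.comp h.continuous).sub hv.continuous) (fun x => ?_) (hufib _ _ hjy.symm)
    rw [apply_comm hc, ← zpow_natCast, hv.map_zpow, hv.map_zpow, add_sub_add_right_eq_sub]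
  rw [hy, sub_self, sub_eq_zero] at hdiff
  refine hne j (eq_of_mem_orbitClosure (hf j).continuous ((hf j).map_pow_of_dvd ?_)
    (hvfib _ _ hdiff.symm))
  exact Finset.dvd_prod_of_mem (fun i : ℕ => d i) (Finset.mem_range.2 hj)

theorem dvd_card_of_free_perm {α : Type*} [Fintype α] [Nonempty α] {σ : Equiv.Perm α} {n : ℕ}
    (hn : 0 < n) (h1 : σ ^ n = 1) (h2 : ∀ i, 0 < i → i < n → ∀ a, (σ ^ i) a ≠ a) :
    n ∣ Fintype.card α := by
  classical
  have hord : orderOf σ = n := by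
    rw [orderOf_eq_iff hn]
    refine ⟨h1, fun i hi hi0 he => ?_⟩
    obtain ⟨a⟩ := ‹Nonempty α›
    exact h2 i hi0 hi a (by rw [he]; rfl)
  have hstab : ∀ a : α, MulAction.stabilizer (Subgroup.zpowers σ) a = ⊥ := by
    intro a
    rw [eq_bot_iff]
    rintro ⟨τ, hτ⟩ ha
    obtain ⟨i, hi, rfl⟩ := Finset.mem_image.1 (mem_zpowers_iff_mem_range_orderOf.1 hτ)
    rw [Finset.mem_range, hord] at hi
    have ha' : (σ ^ i) a = a := ha
    rcases Nat.eq_zero_or_pos i with rfl | hi0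
    · exact Subtype.ext (pow_zero σ)
    · exact (h2 i hi0 hi a ha').elim
  have hcard := MulAction.card_eq_sum_card_group_div_card_stabilizer (Subgroup.zpowers σ) α
  rw [hcard]
  refine Finset.dvd_sum fun ω _ => ?_
  have h3 : Fintype.card (MulAction.stabilizer (Subgroup.zpowers σ) (Quotient.out ω)) = 1 := by
    rw [← Nat.card_eq_fintype_card, hstab, Subgroup.card_bot]
  rw [h3, Nat.div_one, Fintype.card_zpowers, hord]

/-- An element of order `n` all of whose nontrivial powers are, on each nonempty periodic clopen
set, different from the identity permutes the minimal components of a suitable power of `T` freely,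
so `n` divides their number. -/
theorem IsRegularlyRecurrent.mem_heightPeriods_of_free [T3Space X] (hz : IsRegularlyRecurrent T z)
    {g : X ≃ₜ X} (hg : g ∈ stabilizedAut T) {n : ℕ} (hn : 0 < n) (hpow : g ^ n = 1)
    (hid : ∀ i, 0 < i → i < n → ∀ V, IsPeriodicClopen T V → V.Nonempty → ∃ x ∈ V, (g ^ i) x ≠ x) :
    n ∈ heightPeriods T := by
  obtain ⟨m, hm, hc⟩ := mem_stabilizedAut_iff.1 hg
  have hex : ∀ i, ∃ d : ℕ, 0 < d ∧ ∃ f : X → ZMod d, IsHeight T d f ∧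
      (0 < i → i < n → ∀ y, f ((g ^ i) y) ≠ f y) := by
    intro i
    by_cases hi : 0 < i ∧ i < n
    · obtain ⟨d, hd, f, hf, hne⟩ := hz.exists_height_apply_ne (Subgroup.pow_mem _ hg i)
        (hid i hi.1 hi.2)
      exact ⟨d, hd, f, hf, fun _ _ => hne⟩
    · exact ⟨1, one_pos, fun _ => 0, ⟨continuous_const, fun _ => Subsingleton.elim _ _⟩,
        fun h1 h2 => (hi ⟨h1, h2⟩).elim⟩
  choose d hd f hf hne using hex
  obtain ⟨c, hc0, hcM, u, hu, -, hufib⟩ := hz.exists_height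
    (m := m * ∏ i ∈ Finset.range n, d i) (Nat.mul_pos hm (Finset.prod_pos fun i _ => hd i))
  have : NeZero c := ⟨hc0.ne'⟩
  set M := m * ∏ i ∈ Finset.range n, d i
  have hfac : ∀ {φ : X ≃ₜ X}, Commute φ (T ^ M) → ∀ {x y}, u x = u y → u (φ x) = u (φ y) := by
    intro φ hφ x y hxy
    refine (eq_of_mem_orbitClosure (T := T) (m := M) (F := fun x => u (φ x))
      (hu.continuous.comp φ.continuous) (fun x => ?_) (hufib _ _ hxy)).symm
    rw [apply_comm hφ, hu.map_pow_of_dvd hcM]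
  have hgM : Commute g (T ^ M) := by rw [pow_mul]; exact hc.pow_right _
  have hinvl : ∀ x, g⁻¹ (g x) = x := g.symm_apply_apply
  have hinvr : ∀ x, g (g⁻¹ x) = x := g.apply_symm_apply
  have hsurj := hu.surjective z
  set r := Function.surjInv hsurj
  have hr : ∀ a, u (r a) = a := Function.surjInv_eq hsurj
  let σ : Equiv.Perm (ZMod c) :=
    { toFun := fun a => u (g (r a))
      invFun := fun a => u (g⁻¹ (r a))
      left_inv := fun a => by dsimp only; rw [hfac hgM.inv_left (hr _), hinvl, hr]
      right_inv := fun a => by dsimp only; rw [hfac hgM (hr _), hinvr, hr] }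
  have hσ : ∀ i x, (σ ^ i) (u x) = u ((g ^ i) x) := by
    intro i
    induction i with
    | zero => intro x; rfl
    | succ i ih =>
      intro x
      rw [pow_succ, pow_succ, Equiv.Perm.mul_apply, Homeomorph.mul_apply, ← ih]
      exact congrArg _ (hfac hgM (hr _))
  refine mem_heightPeriods_of_dvd (e := c) ?_ ⟨hc0, u, hu⟩
  rw [← ZMod.card c]
  refine dvd_card_of_free_perm (σ := σ) hn (Equiv.ext fun a => ?_) fun i hi0 hi a ha => ?_
  · obtain ⟨x, rfl⟩ := hsurj a
    rw [hσ, hpow]; rfl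
  · obtain ⟨x, rfl⟩ := hsurj a
    rw [hσ] at ha
    refine hne i hi0 hi x (eq_of_mem_orbitClosure (hf i).continuous ((hf i).map_pow_of_dvd ?_)
      (hufib _ _ ha.symm))
    exact (Finset.dvd_prod_of_mem d (Finset.mem_range.2 hi)).mul_left m

/-- For a height `f` of period `n`, the homeomorphism that follows `T` through the fibres of `f`,
but returns from the last fibre to the first one by `T ^ (1 - n)`, has order `n`. -/
theorem IsHeight.exists_cyclic {n : ℕ} (hn : 0 < n) {f : X → ZMod n} (hf : IsHeight T n f) :
    ∃ g ∈ stabilizedAut T, g ^ n = 1 ∧ ∀ (i : ℕ) (x : X), f ((g ^ i) x) = f x + i := by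
  have : NeZero n := ⟨hn.ne'⟩
  have hTn : ∀ x, f ((T ^ (-(n : ℤ))) x) = f x := fun x => by rw [hf.map_zpow]; simp
  have hV := hf.isPeriodicClopen_fibre hn (-1)
  have hinv : ∀ x, (T ^ (-(n : ℤ))) x ∈ f ⁻¹' {-1} ↔ x ∈ f ⁻¹' {-1} := fun x => by
    rw [Set.mem_preimage, hTn, Set.mem_preimage]
  have hT : T ∈ stabilizedAut T :=
    mem_stabilizedAut_iff.2 ⟨1, one_pos, by rw [pow_one]⟩
  let w := localize (T ^ (-(n : ℤ))) (f ⁻¹' {-1}) hV.isClopen hinv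
  have hw : ∀ x, f (w x) = f x := by
    intro x
    by_cases hx : x ∈ f ⁻¹' {-1}
    · exact (congrArg f (localize_apply_of_mem hx)).trans (hTn x)
    · exact congrArg f (localize_apply_of_notMem hx)
  let g := T * w
  have hstep : ∀ x, f (g x) = f x + 1 := fun x => by
    change f (T (w x)) = _
    rw [hf.map_apply, hw]
  have hgi : ∀ (i : ℕ) (x : X), f ((g ^ i) x) = f x + i := by
    intro i
    induction i with
    | zero => simp
    | succ i ih =>
      intro x
      rw [add_comm, pow_add_apply, pow_one, hstep, ih]; push_cast; ring
  have hTpow : ∀ y, f y = 0 → ∀ j : ℕ, j < n → (g ^ j) y = (T ^ j) y := by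
    intro y hy j
    induction j with
    | zero => simp
    | succ j ih =>
      intro hj
      rw [add_comm, pow_add_apply, pow_add_apply, pow_one, pow_one, ih (by omega)]
      refine congrArg T (localize_apply_of_notMem fun hmem => ?_)
      have h1 : f ((T ^ j) y) = -1 := hmem
      rw [← zpow_natCast, hf.map_zpow, hy, zero_add] at h1
      have h2 : ((j + 1 : ℕ) : ZMod n) = 0 := by
        push_cast at h1 ⊢
        rw [h1]; ring
      exact absurd (Nat.le_of_dvd (by omega) ((ZMod.natCast_eq_zero_iff _ _).1 h2)) (by omega)
  have hzero : ∀ y, f y = 0 → (g ^ n) y = y := by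
    intro y hy
    obtain ⟨k, rfl⟩ : ∃ k, n = 1 + k := ⟨n - 1, by omega⟩
    have hmem : (T ^ k) y ∈ f ⁻¹' {-1} := by
      change f ((T ^ k) y) = -1
      rw [← zpow_natCast, hf.map_zpow, hy, zero_add]
      have h0 : ((1 + k : ℕ) : ZMod (1 + k)) = 0 := ZMod.natCast_self _
      push_cast at h0 ⊢
      linear_combination h0
    rw [pow_add_apply, pow_one, hTpow y hy k (by omega)]
    change T (w ((T ^ k) y)) = y
    rw [show w ((T ^ k) y) = _ from localize_apply_of_mem hmem, ← zpow_natCast T k,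
      ← zpow_add_apply]
    conv_lhs => rw [← zpow_one T, ← zpow_mul, one_mul, ← zpow_add_apply]
    simp
  refine ⟨g, Subgroup.mul_mem _ hT (hV.localize_mem (Subgroup.zpow_mem _ hT _) hinv),
    Homeomorph.ext fun x => ?_, hgi⟩
  -- each point is `g ^ i y` for some `y` in the zero fibre
  have hy : f ((T ^ (-((f x).val : ℤ))) x) = 0 := by rw [hf.map_zpow]; simp
  have hx : (g ^ (f x).val) ((T ^ (-((f x).val : ℤ))) x) = x := by
    rw [hTpow _ hy _ (ZMod.val_lt _), ← zpow_natCast, zpow_apply_neg_apply]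
  change (g ^ n) x = x
  conv_lhs => rw [← hx]
  rw [← pow_add_apply, add_comm, pow_add_apply, hzero _ hy, hx]

/-- The height periods of an infinite regularly recurrent system are the orders of the elements of
the stabilized automorphism group all of whose nontrivial powers are algebraically free. -/
theorem IsRegularlyRecurrent.mem_heightPeriods_iff [T3Space X] [Infinite X]
    (hz : IsRegularlyRecurrent T z) {n : ℕ} :
    n ∈ heightPeriods T ↔ 0 < n ∧ ∃ g : stabilizedAut T, g ^ n = 1 ∧
      ∀ i, 0 < i → i < n → IsAlgebraicallyFree (g ^ i) := by
  constructor
  · rintro ⟨hn, f, hf⟩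
    obtain ⟨g, hg, hpow, hgf⟩ := hf.exists_cyclic hn
    have hpow' : (⟨g, hg⟩ : stabilizedAut T) ^ n = 1 := Subtype.ext hpow
    refine ⟨hn, ⟨g, hg⟩, hpow', fun i hi0 hi => ?_⟩
    refine hz.isAlgebraicallyFree_of_fixedPointFree hn
      (by rw [← pow_mul, mul_comm, pow_mul, hpow', one_pow]) fun x hx => ?_
    have h1 := hgf i x
    have h2 : (g ^ i) x = x := hx
    rw [h2, left_eq_add, ZMod.natCast_eq_zero_iff] at h1
    exact absurd (Nat.le_of_dvd hi0 h1) (by omega)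
  · rintro ⟨hn, g, hpow, hfree⟩
    refine hz.mem_heightPeriods_of_free g.2 hn (congrArg Subtype.val hpow)
      fun i hi0 hi V hV hne => ?_
    by_contra! hid
    exact hz.not_isAlgebraicallyFree hV hne (h := g ^ i) hid (hfree i hi0 hi)

/-- The period set of a finite regularly recurrent system consists of the divisors of its size. -/
theorem IsRegularlyRecurrent.mem_heightPeriods_iff_dvd_card [T3Space X] [Finite X]
    (hz : IsRegularlyRecurrent T z) {n : ℕ} : n ∈ heightPeriods T ↔ n ∣ Nat.card X := by
  have : Nonempty X := ⟨z⟩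
  have hcard : ∃ u : X → ZMod (Nat.card X), IsHeight T (Nat.card X) u ∧ Function.Injective u := by
    obtain ⟨p, hp, hpz⟩ := hz.recurrent {z} ((isOpen_discrete _).mem_nhds rfl)
    obtain ⟨c, hc, -, f, hf, -, hfib⟩ := hz.exists_height hp
    have hTp : T ^ p = 1 := by
      refine Homeomorph.ext (congrFun (Continuous.ext_on hz.dense (T ^ p).continuous
        continuous_id ?_))
      rintro _ ⟨k, rfl⟩
      have h1 : (T ^ p) z = z := by simpa using hpz 1
      change (T ^ p) ((T ^ k) z) = (T ^ k) z
      rw [apply_comm ((Commute.refl T).pow_left p |>.zpow_right k), h1]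
    have hinj : Function.Injective f := fun x y hxy =>
      (orbitClosure_subset (C := {x}) isClosed_singleton
        (fun k => by rw [zpow_mul, zpow_natCast, hTp, one_zpow]; rfl) (hfib x y hxy)).symm
    have : NeZero c := ⟨hc.ne'⟩
    have hbij := Nat.card_eq_of_bijective f ⟨hinj, hf.surjective z⟩
    rw [hbij, Nat.card_zmod]
    exact ⟨f, hf, hinj⟩
  obtain ⟨u, hu, hinj⟩ := hcard
  refine ⟨?_, fun h => mem_heightPeriods_of_dvd h ⟨Nat.card_pos, u, hu⟩⟩
  rintro ⟨-, f, hf⟩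
  exact dvd_of_height_factors hu hf z fun y hy => by rw [hinj hy]

/-- Every permutation of a discrete space is a homeomorphism. -/
def homeomorphEquivPerm (X : Type*) [TopologicalSpace X] [DiscreteTopology X] :
    (X ≃ₜ X) ≃ Equiv.Perm X where
  toFun φ := φ.toEquiv
  invFun σ := ⟨σ, continuous_of_discreteTopology, continuous_of_discreteTopology⟩
  left_inv _ := rfl
  right_inv _ := rfl

theorem nat_card_stabilizedAut [T1Space X] [Finite X] :
    Nat.card (stabilizedAut T) = (Nat.card X).factorial := by
  have : Finite (X ≃ₜ X) := Finite.of_equiv _ (homeomorphEquivPerm X).symm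
  obtain ⟨n, hn, hT⟩ := (isOfFinOrder_of_finite T).exists_pow_eq_one
  have htop : stabilizedAut T = ⊤ := by
    rw [eq_top_iff]
    exact fun φ _ => mem_stabilizedAut_iff.2 ⟨n, hn, by rw [hT]; exact Commute.one_right φ⟩
  rw [htop, Nat.card_congr (Subgroup.topEquiv.toEquiv.trans (homeomorphEquivPerm X)),
    Nat.card_perm]

theorem IsRegularlyRecurrent.infinite_stabilizedAut [T3Space X] [Infinite X]
    (hz : IsRegularlyRecurrent T z) : Infinite (stabilizedAut T) := by
  by_contra hfin
  rw [not_infinite_iff_finite] at hfin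
  have hT : T ∈ stabilizedAut T := mem_stabilizedAut_iff.2 ⟨1, one_pos, by rw [pow_one]⟩
  obtain ⟨n, hn, h⟩ := (isOfFinOrder_of_finite (⟨T, hT⟩ : stabilizedAut T)).exists_pow_eq_one
  have h1 : T ^ n = 1 := congrArg Subtype.val h
  have := hz.finite_of_pow_apply_eq hn (x := z) (by rw [h1]; rfl)
  exact not_finite X

/-- The height periods of a regularly recurrent system are determined by its stabilized automorphism
group. -/
theorem heightPeriods_eq_of_mulEquiv {Y : Type*} [TopologicalSpace Y] [T3Space X] [T3Space Y]
    {S : Y ≃ₜ Y} {y : Y} (hz : IsRegularlyRecurrent T z) (hy : IsRegularlyRecurrent S y)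
    (e : stabilizedAut T ≃* stabilizedAut S) : heightPeriods T = heightPeriods S := by
  ext n
  rcases finite_or_infinite X with hX | hX <;> rcases finite_or_infinite Y with hY | hY
  · have hcard := Nat.card_congr e.toEquiv
    rw [nat_card_stabilizedAut, nat_card_stabilizedAut] at hcard
    have : Nonempty X := ⟨z⟩
    have : Nonempty Y := ⟨y⟩
    have h1 := (Nat.factorial_lt (Nat.card_pos (α := X)) (m := Nat.card Y)).not.1 hcard.not_lt
    have h2 := (Nat.factorial_lt (Nat.card_pos (α := Y)) (m := Nat.card X)).not.1 hcard.not_gt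
    rw [hz.mem_heightPeriods_iff_dvd_card, hy.mem_heightPeriods_iff_dvd_card,
      show Nat.card X = Nat.card Y by omega]
  · have hinf := hy.infinite_stabilizedAut
    have : Finite (X ≃ₜ X) := Finite.of_equiv _ (homeomorphEquivPerm X).symm
    exact (not_finite_iff_infinite.2 hinf (Finite.of_equiv _ e.toEquiv)).elim
  · have hinf := hz.infinite_stabilizedAut
    have : Finite (Y ≃ₜ Y) := Finite.of_equiv _ (homeomorphEquivPerm Y).symm
    exact (not_finite_iff_infinite.2 hinf (Finite.of_equiv _ e.symm.toEquiv)).elim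
  · rw [hz.mem_heightPeriods_iff, hy.mem_heightPeriods_iff]
    refine and_congr_right fun _ => ⟨?_, ?_⟩
    · rintro ⟨g, hg, hfree⟩
      exact ⟨e g, by rw [← map_pow, hg, map_one], fun i h1 h2 => by
        rw [← map_pow]; exact (hfree i h1 h2).map e⟩
    · rintro ⟨g, hg, hfree⟩
      exact ⟨e.symm g, by rw [← map_pow, hg, map_one], fun i h1 h2 => by
        rw [← map_pow]; exact (hfree i h1 h2).map e.symm⟩

end Recover

/-! ### Toeplitz subshifts -/

theorem subshiftHomeo_zpow_apply {A : Type*} [TopologicalSpace A] (X : Subshift A ℤ) (k : ℤ)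
    (x : X.carrier) : ((subshiftHomeo X ^ k) x).1 = shift k x.1 := by
  induction k generalizing x with
  | zero => ext n; simp
  | succ i ih =>
    rw [zpow_add_apply, zpow_one, ih]
    ext n
    exact congrArg x.1 (by ring)
  | pred i ih =>
    rw [sub_eq_add_neg, zpow_add_apply, ih, zpow_neg_one]
    ext n
    exact congrArg x.1 (by ring)

theorem IsToeplitzSubshift.exists_isRegularlyRecurrent {A : Type*} [TopologicalSpace A]
    [DiscreteTopology A] {X : Subshift A ℤ} (hX : IsToeplitzSubshift X) :
    ∃ z : X.carrier, IsRegularlyRecurrent (subshiftHomeo X) z := by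
  obtain ⟨x, hx, hXx⟩ := hX
  have hmem : x ∈ X.carrier := by
    rw [hXx]
    exact subset_closure ⟨0, by ext n; simp⟩
  refine ⟨⟨x, hmem⟩, ⟨?_, fun V hV => ?_⟩⟩
  · intro y
    rw [closure_subtype, ← Set.range_comp]
    have : (Subtype.val ∘ fun k : ℤ => (subshiftHomeo X ^ k) ⟨x, hmem⟩) =
        fun k : ℤ => shift k x := funext fun k => subshiftHomeo_zpow_apply X k _
    rw [this, ← hXx]
    exact y.2
  · rw [nhds_subtype, Filter.mem_comap] at hV
    obtain ⟨W, hW, hWV⟩ := hV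
    rw [nhds_pi, Filter.mem_pi'] at hW
    obtain ⟨I, t, ht, hIW⟩ := hW
    choose p hp hpx using hx
    refine ⟨∏ n ∈ I, p n, Finset.prod_pos fun n _ => hp n, fun k => hWV (hIW fun n hn => ?_)⟩
    rw [subshiftHomeo_zpow_apply]
    obtain ⟨q, hq⟩ := Finset.dvd_prod_of_mem p hn
    have : shift (((∏ n ∈ I, p n : ℕ) : ℤ) * k) x n = x n := by
      rw [← hpx n (q * k), hq]
      exact congrArg x (by push_cast; ring)
    rw [this]
    exact mem_of_mem_nhds (ht n)

instance {A : Type*} [Finite A] [TopologicalSpace A] (X : Subshift A ℤ) :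
    CompactSpace X.carrier :=
  isCompact_iff_compactSpace.mp X.isClosed.isCompact

theorem mainTheorem10 {A : Type uA} {B : Type uB}
    [Finite A] [TopologicalSpace A] [DiscreteTopology A]
    [Finite B] [TopologicalSpace B] [DiscreteTopology B]
    (X : Subshift A ℤ) (Y : Subshift B ℤ)
    (hX : IsToeplitzSubshift X) (hY : IsToeplitzSubshift Y)
    (hXY : Nonempty (stabilizedAut (subshiftHomeo X) ≃* stabilizedAut (subshiftHomeo Y))) :
    ∃ s : OdometerScale,
      IsMaximalEquicontinuousFactor.{uA, 0, uW} (subshiftHomeo X) (odometerHomeo s) ∧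
      IsMaximalEquicontinuousFactor.{uB, 0, uW} (subshiftHomeo Y) (odometerHomeo s) ∧
      (Infinite X.carrier ∨ Infinite Y.carrier → Infinite (Odometer s)) := by
  obtain ⟨x, hx⟩ := hX.exists_isRegularlyRecurrent
  obtain ⟨y, hy⟩ := hY.exists_isRegularlyRecurrent
  obtain ⟨e⟩ := hXY
  have hD := heightPeriods_eq_of_mulEquiv hx hy e
  let s := scaleOfPeriods (heightPeriods (subshiftHomeo X)) fun _ hd => hd.1
  have hs : ∀ n, s.period n ∈ heightPeriods (subshiftHomeo X) := hx.scaleOfPeriods_mem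
  have hs' : ∀ d ∈ heightPeriods (subshiftHomeo X), ∃ n, d ∣ s.period n := fun d hd =>
    ⟨d, dvd_scaleOfPeriods hd⟩
  refine ⟨s, hx.isMaximalEquicontinuousFactor s hs hs',
    hy.isMaximalEquicontinuousFactor s (hD ▸ hs) (hD ▸ hs'), ?_⟩
  rintro (h | h)
  · exact hx.infinite_odometer s hs hs'
  · exact hy.infinite_odometer s (hD ▸ hs) (hD ▸ hs')
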